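/- Let $\mathbb V=\bigoplus_{n\in\mathbb N}\mathbb V(n)$ be an $\mathbb N$-graded vertex operator algebra (with $\dim\mathbb V(n)<\infty$), and let $\mathbb M$ be a grading-restricted generalized $\mathbb V$-module: $\mathbb M=\bigoplus_{\lambda\in\mathbb C}\mathbb M_{[\lambda]}$, where $\mathbb M_{[\lambda]}$ is the generalized $\lambda$-eigenspace of $L(0)$, each $\mathbb M_{[\lambda]}$ is finite-dimensional, and $\mathbb M_{[\lambda-n]}=0$ for each $\lambda$ and all sufficiently large integers $n$. Let $A$ be a unital subalgebra of $\mathrm{End}_{\mathbb V}(\mathbb M)^{\mathrm{op}}$ such that $\mathbb M$ is projective as a right $A$-module, and let $\omega:A\to\mathbb C$ be linear with $\omega(ab)=\omega(ba)$ for all $a,b\in A$. Let $\mathrm{End}^0(\mathbb M)=\bigoplus_{\lambda,\mu}\mathrm{Hom}_{\mathbb C}(\mathbb M_{[\mu]},\mathbb M_{[\lambda]})$, and let $\mathrm{End}^0_A(\mathbb M)$ be the space of its elements commuting with $A$, with the two actions of $\mathbb V$ $$Y(v\otimes\mathbf 1,z)T=Y_{\mathbb M}(v,z)\circ T,\qquad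 Y(\mathbf 1\otimes v,z)T=T\circ Y_{\mathbb M}(\mathcal U(\gamma_z)v,z^{-1}),\qquad \mathcal U(\gamma_z)=e^{zL(1)}(-z^{-2})^{L(0)},\quad \gamma_z(t)=\tfrac1{z+t}-\tfrac1z .$$ Let $\mathrm{Tr}^\omega:\mathrm{End}^0_A(\mathbb M)\to\mathbb C$ be the pseudo-trace (Hattori-Stallings trace) of $\omega$: $\mathrm{Tr}^\omega(T)=\sum_i\omega(\alpha_i(u_i))$ whenever $T=\sum_i u_i\,\alpha_i(\cdot)$ is a finite sum with $u_i\in\mathbb M$ and $\alpha_i\in\mathrm{Hom}_A(\mathbb M,A)$. Let $B$ be a complex manifold and consider the constant family of $2$-pointed spheres with local coordinates $(\mathbb P^1\times B\to B\,|\,\infty,0;1/z,z)$, with divisor of marked points $S$, relative dualizing sheaf $\omega_{\mathbb P^1\times B/B}$, and sheaf of vertex operator algebras $\mathscr V$, i.e. the $\mathcal O$-module which is trivialized as $\mathbb V\otimes\mathcal O$ by $z$ on $\mathbb C\times B$ and by $1/z$ on $(\mathbb P^1\setminus\{0\})\times B$, with transition function $\mathcal U(\gamma_z)$ from the first to the second.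 Associate $\mathrm{End}^0_A(\mathbb M)$ to the marked points $(\infty,0)$, the first action of $\mathbb V$ being associated to $\infty$ and the second to $0$. Then $\mathrm{Tr}^\omega$, viewed as a linear map $\mathrm{End}^0_A(\mathbb M)\to\mathcal O(B)$ with constant values, is a conformal block for this family: for every open $D\subset B$, every section $\sigma$ of $\mathscr V\otimes\omega_{\mathbb P^1\times B/B}(\bullet S)$ over $\mathbb P^1\times D$, and every $w\in\mathrm{End}^0_A(\mathbb M)\otimes\mathcal O_B$ over $D$, the $\mathcal O_B$-linear extension of $\mathrm{Tr}^\omega$ vanishes on the residue action $\sigma\cdot w$, the sum of $\mathrm{Res}_{1/z=0}\,Y(\sigma\otimes\mathbf 1,1/z)w$ and $\mathrm{Res}_{z=0}\,Y(\mathbf 1\otimes\sigma,z)w$, where $\sigma$ is expressed in the trivialization by $1/z$ and by $z$ respectively. Equivalently, $\mathrm{Tr}^\omega(Y_{\mathbb M}(v,z)\circ T)=\mathrm{Tr}^\omega(T\circ Y_{\mathbb M}(v,z))$ in $\mathbb C[[z^{\pm1}]]$ for all $v\in\mathbb V$ and $T\in\mathrm{End}^0_A(\mathbb M)$; this identity holds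 as well. -/

import Mathlib

open scoped Manifold Topology

noncomputable section

namespace PseudoTraceBlock

/-! ### Vertex operators and their modes -/

section Modes

variable {V M : Type*} [AddCommGroup V] [Module ℂ V] [AddCommGroup M] [Module ℂ M]

/-- The mode `Y(v)_n` of `Y(v,z) = ∑ Y(v)_n z^{-n-1}`, linear in `v`. -/
def mode (Y : V →ₗ[ℂ] VertexOperator ℂ M) (n : ℤ) : V →ₗ[ℂ] Module.End ℂ M where
  toFun v := VertexOperator.ncoeff (Y v) n
  map_add' u v := by simp
  map_smul' r v := by simp

theorem mode_eventually_zero (Y : V →ₗ[ℂ] VertexOperator ℂ M) (v : V) (x : M) :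
    ∃ N : ℤ, ∀ n ≥ N, mode Y n v x = 0 := by
  refine ⟨-HahnSeries.order ((HahnModule.of ℂ).symm (Y v x)), fun n hn => ?_⟩
  exact VertexOperator.ncoeff_eq_zero_of_lt_order (Y v) n x (by omega)

/-- The vertex operator map with prescribed modes. -/
def ofModes (f : ℤ → V →ₗ[ℂ] Module.End ℂ M)
    (hf : ∀ v x, ∃ N : ℤ, ∀ n ≥ N, f n v x = 0) : V →ₗ[ℂ] VertexOperator ℂ M where
  toFun v := VertexOperator.of_coeff (fun y => f (-y - 1) v) (by
    intro x
    obtain ⟨N, hN⟩ := hf v x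
    refine ⟨-N - 1, fun y hy => ?_⟩
    by_contra hlt
    exact hy (hN _ (by omega)))
  map_add' u v := by
    apply HVertexOperator.coeff_inj
    funext n
    ext x
    simp [VertexOperator.of_coeff, -VertexOperator.coeff_eq_ncoeff]
  map_smul' r v := by
    apply HVertexOperator.coeff_inj
    funext n
    ext x
    simp [VertexOperator.of_coeff, -VertexOperator.coeff_eq_ncoeff]

theorem mode_ofModes (f : ℤ → V →ₗ[ℂ] Module.End ℂ M)
    (hf : ∀ v x, ∃ N : ℤ, ∀ n ≥ N, f n v x = 0) (n : ℤ) : mode (ofModes f hf) n = f n := by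
  ext v x
  have := congrFun (congrArg DFunLike.coe (VertexOperator.ncoeff_of_coeff (fun y => f (-y - 1) v) (by
    intro x
    obtain ⟨N, hN⟩ := hf v x
    refine ⟨-N - 1, fun y hy => ?_⟩
    by_contra hlt
    exact hy (hN _ (by omega))) n)) x
  simpa only [mode, ofModes, sub_neg_eq_add, neg_sub, neg_add_rev, neg_neg, LinearMap.coe_mk, AddHom.coe_mk, add_sub_cancel_left, show -(-n - 1) - 1 = n by ring] using this

/-- The Borcherds identity (the Jacobi identity in components) for an action `YM` on `M` of the vertex
algebra with state-field map `Y`. -/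
def BorcherdsIdentity (Y : V →ₗ[ℂ] VertexOperator ℂ V) (YM : V →ₗ[ℂ] VertexOperator ℂ M) : Prop :=
  ∀ (a b : V) (x : M) (m k n : ℤ),
    ∑ᶠ j : ℕ, ((Ring.choose m j : ℤ) : ℂ) • mode YM (m + n - j) (mode Y (k + j) a b) x =
    ∑ᶠ j : ℕ, ((-1 : ℂ) ^ j * ((Ring.choose k j : ℤ) : ℂ)) •
      (mode YM (m + k - j) a (mode YM (n + j) b x) -
        (-1 : ℂ) ^ k • mode YM (n + k - j) b (mode YM (m + j) a x))

end Modes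

/-! ### Vertex operator algebras and modules -/

/-- An `ℕ`-graded vertex operator algebra structure on the complex vector space `V`. -/
structure VOA (V : Type*) [AddCommGroup V] [Module ℂ V] where
  /-- the state-field correspondence -/
  Y : V →ₗ[ℂ] VertexOperator ℂ V
  /-- the vacuum vector -/
  vac : V
  /-- the conformal vector -/
  conf : V
  /-- the central charge -/
  charge : ℂ
  /-- the weight spaces `V(n)` -/
  gr : ℕ → Submodule ℂ V
  gr_internal : DirectSum.IsInternal gr
  gr_finite : ∀ n, FiniteDimensional ℂ (gr n)
  vac_mem : vac ∈ gr 0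
  conf_mem : conf ∈ gr 2
  mode_vac : ∀ n, mode Y n vac = if n = -1 then 1 else 0
  mode_apply_vac : ∀ v, ∀ n : ℕ, mode Y n v vac = 0
  mode_neg_one_apply_vac : ∀ v, mode Y (-1) v vac = v
  borcherds : BorcherdsIdentity Y Y
  virasoro : ∀ m n : ℤ,
    mode Y (m + 1) conf * mode Y (n + 1) conf - mode Y (n + 1) conf * mode Y (m + 1) conf =
      ((m : ℂ) - n) • mode Y (m + n + 1) conf +
        (if m + n = 0 then ((m : ℂ) ^ 3 - m) / 12 * charge else 0) • (1 : Module.End ℂ V)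
  L_zero : ∀ n, ∀ v ∈ gr n, mode Y 1 conf v = (n : ℂ) • v
  L_neg_one : ∀ v (n : ℤ), mode Y n (mode Y 0 conf v) = -(n : ℂ) • mode Y (n - 1) v

/-- A weak module for the vertex operator algebra `𝕍` on the complex vector space `M`. -/
structure VOA.WeakModule {V : Type*} [AddCommGroup V] [Module ℂ V] (𝕍 : VOA V)
    (M : Type*) [AddCommGroup M] [Module ℂ M] where
  /-- the vertex operators `Y_M(v,z)` -/
  Y : V →ₗ[ℂ] VertexOperator ℂ M
  mode_vac : ∀ n, mode Y n 𝕍.vac = if n = -1 then 1 else 0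
  borcherds : BorcherdsIdentity 𝕍.Y Y
  L_neg_one : ∀ v (n : ℤ), mode Y n (mode 𝕍.Y 0 𝕍.conf v) = -(n : ℂ) • mode Y (n - 1) v

section VOA

variable {V : Type*} [AddCommGroup V] [Module ℂ V] (𝕍 : VOA V)

/-- The Virasoro operator `L(n)` on `V`. -/
def VOA.L (n : ℤ) : Module.End ℂ V := mode 𝕍.Y (n + 1) 𝕍.conf

/-- The decomposition `V ≃ ⨁ V(n)`. -/
def VOA.decomp : V ≃ₗ[ℂ] DirectSum ℕ (fun d => 𝕍.gr d) :=
  (LinearEquiv.ofBijective (DirectSum.coeLinearMap 𝕍.gr)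
    (show Function.Bijective (DirectSum.coeLinearMap 𝕍.gr) from 𝕍.gr_internal)).symm

theorem VOA.decomp_of_mem {d : ℕ} {v : V} (hv : v ∈ 𝕍.gr d) :
    𝕍.decomp v = DirectSum.lof ℂ ℕ (fun d => 𝕍.gr d) d ⟨v, hv⟩ := by
  rw [VOA.decomp, LinearEquiv.symm_apply_eq, LinearEquiv.ofBijective_apply]
  exact (DirectSum.coeLinearMap_lof 𝕍.gr d ⟨v, hv⟩).symm

/-- Induction principle: every vector is a sum of homogeneous ones. -/
theorem VOA.homogeneous_induction {p : V → Prop} (v : V)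
    (h : ∀ d, ∀ v ∈ 𝕍.gr d, p v) (h0 : p 0) (hadd : ∀ u v, p u → p v → p (u + v)) : p v := by
  have hv : v ∈ iSup 𝕍.gr := by
    rw [𝕍.gr_internal.submodule_iSup_eq_top]; trivial
  exact Submodule.iSup_induction 𝕍.gr (motive := p) hv h h0 hadd

end VOA

/-! ### Change of coordinate operators -/

section Huang

open PowerSeries

/-- The vector field `∑_{n ≥ 1} c_n z^{n+1} ∂_z` acting on formal power series; the scalar `c_n` is
stored as `c (n - 1)`, so that the field is `(∑_{i ≥ 0} c i z^{i+2}) ∂_z`. -/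
def flowStep (c : ℕ → ℂ) (f : PowerSeries ℂ) : PowerSeries ℂ :=
  (X ^ 2 * PowerSeries.mk c) * PowerSeries.derivative ℂ f

/-- The power series `exp (∑_{n ≥ 1} c_n z^{n+1} ∂_z) z`. Since the `k`-th iterate of the vector field
sends `z` into `z^{k+1} ℂ⟦z⟧`, the coefficient of `z^m` is the finite sum over `k ≤ m`. -/
def flow (c : ℕ → ℂ) : PowerSeries ℂ :=
  PowerSeries.mk fun m => ∑ k ∈ Finset.range (m + 1),
    ((k.factorial : ℂ)⁻¹) * coeff m ((flowStep c)^[k] X)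

/-- The unique scalars `c_1, c_2, …` (`c_n` stored at `n - 1`) such that
`α(z) = α'(0) · exp (∑_{n ≥ 1} c_n z^{n+1} ∂_z) z`, for `α` with `α(0) = 0` and `α'(0) ≠ 0`. They are
computed recursively; see `eq_smul_flow_logCoeff` and `logCoeff_unique`. -/
def logCoeff (α : PowerSeries ℂ) : ℕ → ℂ
  | m => coeff (m + 2) α / coeff 1 α -
      coeff (m + 2) (flow fun i => if _h : i < m then logCoeff α i else 0)

theorem coeff_flowStep_add_two (c : ℕ → ℂ) (f : PowerSeries ℂ) (j : ℕ) :
    coeff (j + 2) (flowStep c f) =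
      ∑ p ∈ Finset.HasAntidiagonal.antidiagonal j, c p.1 * (coeff (p.2 + 1) f * (p.2 + 1)) := by
  unfold flowStep
  rw [mul_assoc, coeff_X_pow_mul, coeff_mul]
  simp [coeff_derivative]

theorem coeff_flowStep_lt (c : ℕ → ℂ) (f : PowerSeries ℂ) (j : ℕ) (hj : j < 2) :
    coeff j (flowStep c f) = 0 := by
  unfold flowStep
  rw [mul_assoc, coeff_X_pow_mul', if_neg (by omega)]

theorem coeff_iter_congr {c c' : ℕ → ℂ} {m : ℕ} (h : ∀ i < m, c i = c' i) (k : ℕ) :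
    (∀ j ≤ m + 1, coeff j ((flowStep c)^[k] X) = coeff j ((flowStep c')^[k] X)) ∧
    (k ≠ 1 → coeff (m + 2) ((flowStep c)^[k] X) = coeff (m + 2) ((flowStep c')^[k] X)) := by
  induction k with
  | zero => simp
  | succ k ih =>
    simp only [Function.iterate_succ_apply']
    constructor
    · intro j hj
      rcases lt_or_ge j 2 with h2 | h2
      · rw [coeff_flowStep_lt _ _ _ h2, coeff_flowStep_lt _ _ _ h2]
      · obtain ⟨i, rfl⟩ : ∃ i, j = i + 2 := ⟨j - 2, by omega⟩
        rw [coeff_flowStep_add_two, coeff_flowStep_add_two]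
        refine Finset.sum_congr rfl fun p hp => ?_
        have := Finset.HasAntidiagonal.mem_antidiagonal.1 hp
        rw [h p.1 (by omega), ih.1 (p.2 + 1) (by omega)]
    · intro hk
      rw [coeff_flowStep_add_two, coeff_flowStep_add_two]
      refine Finset.sum_congr rfl fun p hp => ?_
      have := Finset.HasAntidiagonal.mem_antidiagonal.1 hp
      rcases Nat.eq_zero_or_pos p.2 with h0 | h0
      · obtain ⟨i, rfl⟩ : ∃ i, k = i + 1 := ⟨k - 1, by omega⟩
        simp only [Function.iterate_succ_apply', h0, zero_add]
        rw [coeff_flowStep_lt _ _ _ (by norm_num), coeff_flowStep_lt _ _ _ (by norm_num)]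
        simp
      · rw [h p.1 (by omega), ih.1 (p.2 + 1) (by omega)]

theorem coeff_flow_sub {c c' : ℕ → ℂ} {m : ℕ} (h : ∀ i < m, c i = c' i) :
    coeff (m + 2) (flow c) - coeff (m + 2) (flow c') = c m - c' m := by
  have e1 : ∀ c : ℕ → ℂ, coeff (m + 2) (flowStep c X) = c m := by
    intro c
    rw [coeff_flowStep_add_two, Finset.sum_eq_single (m, 0)]
    · simp
    · rintro ⟨a, b⟩ hp hne
      have : b ≠ 0 := by
        rintro rfl
        simp at hp hne
        exact hne hp
      simp [coeff_X, this]
    · simp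
  simp only [flow, coeff_mk, ← Finset.sum_sub_distrib]
  rw [Finset.sum_eq_single 1]
  · simp [e1]
  · intro k _ hk
    rw [(coeff_iter_congr h k).2 hk, sub_self]
  · simp

theorem flow_zero_one (c : ℕ → ℂ) : coeff 0 (flow c) = 0 ∧ coeff 1 (flow c) = 1 := by
  constructor
  · simp [flow]
  · simp [flow, Finset.sum_range_succ, coeff_flowStep_lt]

theorem eq_smul_flow_logCoeff (α : PowerSeries ℂ) (h0 : coeff 0 α = 0) (h1 : coeff 1 α ≠ 0) :
    α = coeff 1 α • flow (logCoeff α) := by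
  ext j
  rw [coeff_smul, smul_eq_mul]
  match j with
  | 0 => rw [h0, (flow_zero_one _).1, mul_zero]
  | 1 => rw [(flow_zero_one _).2, mul_one]
  | m + 2 =>
    have := coeff_flow_sub (c := logCoeff α)
      (c' := fun i => if _h : i < m then logCoeff α i else 0) (m := m)
      (by intro i hi; simp [hi])
    have e : logCoeff α m = coeff (m + 2) α / coeff 1 α -
        coeff (m + 2) (flow fun i => if _h : i < m then logCoeff α i else 0) := by
      rw [logCoeff]
    simp only [lt_irrefl, dite_false, sub_zero] at this
    have h2 := this.trans e
    rw [sub_left_inj] at h2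
    rw [h2]; field_simp

theorem logCoeff_unique (α : PowerSeries ℂ) (h1 : coeff 1 α ≠ 0) (c : ℕ → ℂ)
    (hc : α = coeff 1 α • flow c) : c = logCoeff α := by
  have h0 : coeff 0 α = 0 := by rw [hc, coeff_smul, (flow_zero_one _).1, smul_zero]
  have hf : flow c = flow (logCoeff α) := by
    have := hc.symm.trans (eq_smul_flow_logCoeff α h0 h1)
    exact smul_right_injective _ h1 this
  funext m
  induction m using Nat.strong_induction_on with
  | _ m ih =>
    have := coeff_flow_sub (m := m) ih
    rw [hf, sub_self] at this
    exact (sub_eq_zero.1 this.symm)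
variable {V : Type*} [AddCommGroup V] [Module ℂ V] (𝕍 : VOA V)

/-- The operator `∑_{n ≥ 1} c_n L(n)` on `V` (with `c_n` stored as `c (n - 1)`). The sum is finite on
each vector, because `L(n)` lowers the weight by `n`. -/
def VOA.positiveVirasoro (c : ℕ → ℂ) (v : V) : V := ∑ᶠ i : ℕ, c i • 𝕍.L (i + 1) v

/-- The change of coordinate operator `𝒰(α) = α'(0)^{L(0)} exp (∑_{n ≥ 1} c_n L(n))` on `V`, where
`α(z) = α'(0) · exp (∑_{n ≥ 1} c_n z^{n+1} ∂_z) z`. Both sums are finite on each vector. -/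
def VOA.changeOfCoord (α : PowerSeries ℂ) (v : V) : V :=
  ∑ᶠ d : ℕ, (coeff 1 α) ^ d •
    (𝕍.decomp (∑ᶠ k : ℕ, ((k.factorial : ℂ)⁻¹) • (𝕍.positiveVirasoro (logCoeff α))^[k] v) d : V)

/-- The expansion in `t` of `γ_z(t) = 1/(z+t) - 1/z`. For `z ≠ 0` this is the transformation from the
local coordinate `ζ - z` to the local coordinate `1/ζ - 1/z` of `ℙ¹` at the point `ζ = z`. -/
def gammaSeries (z : ℂ) : PowerSeries ℂ := (C z + X)⁻¹ - C z⁻¹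

end Huang

/-! ### Grading-restricted modules, `End⁰_A(M)` and its two vertex operator actions -/

section Module

variable {V : Type*} [AddCommGroup V] [Module ℂ V] {𝕍 : VOA V}
  {M : Type*} [AddCommGroup M] [Module ℂ M] (𝕄 : 𝕍.WeakModule M)

/-- The generalized eigenspace `M_[μ]` of `L(0)`. -/
def VOA.WeakModule.weight (μ : ℂ) : Submodule ℂ M :=
  Module.End.maxGenEigenspace (mode 𝕄.Y 1 𝕍.conf) μ

/-- Grading-restricted generalized modules. -/
structure VOA.WeakModule.GradingRestricted : Prop where
  iSup_weight : ⨆ μ, 𝕄.weight μ = ⊤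
  finite_weight : ∀ μ, FiniteDimensional ℂ (𝕄.weight μ)
  lower_bounded : ∀ μ : ℂ, ∃ N : ℕ, ∀ n ≥ N, 𝕄.weight (μ - n) = ⊥

/-- The algebra `End_𝕍(M)` of module endomorphisms. -/
def VOA.WeakModule.endAlg : Subalgebra ℂ (Module.End ℂ M) :=
  Subalgebra.centralizer ℂ {T | ∃ v n, T = mode 𝕄.Y n v}

/-- `End⁰_A(M)`: the elements of `End⁰(M) = ⨁_{λ,μ} Hom(M_[μ], M_[λ])` which commute with `A`. A linear
map `T` belongs to `End⁰(M)` iff, for some finite set `E` of weights, it takes values in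
`⨁_{λ ∈ E} M_[λ]` and vanishes on `M_[μ]` for all `μ ∉ E`. -/
def VOA.WeakModule.endZero (A : Subalgebra ℂ (Module.End ℂ M)) :
    Submodule ℂ (Module.End ℂ M) where
  carrier := {T | (∀ a ∈ A, T * a = a * T) ∧ ∃ E : Finset ℂ,
    (∀ x, T x ∈ ⨆ μ ∈ E, 𝕄.weight μ) ∧ ∀ μ ∉ E, ∀ x ∈ 𝕄.weight μ, T x = 0}
  zero_mem' := ⟨by simp, ∅, by simp, by simp⟩
  add_mem' := by
    rintro S T ⟨hS, E, hE, hE'⟩ ⟨hT, F, hF, hF'⟩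
    classical
    refine ⟨fun a ha => by rw [add_mul, mul_add, hS a ha, hT a ha], E ∪ F, fun x => ?_,
      fun μ hμ x hx => ?_⟩
    · exact Submodule.add_mem _
        (biSup_mono (f := 𝕄.weight) (fun i hi => Finset.mem_union_left F hi) (hE x))
        (biSup_mono (f := 𝕄.weight) (fun i hi => Finset.mem_union_right E hi) (hF x))
    · simp only [Finset.mem_union, not_or] at hμ
      rw [LinearMap.add_apply, hE' μ hμ.1 x hx, hF' μ hμ.2 x hx, add_zero]
  smul_mem' := by
    rintro r T ⟨hT, E, hE, hE'⟩
    refine ⟨fun a ha => by rw [smul_mul_assoc, mul_smul_comm, hT a ha], E, fun x => ?_,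
      fun μ hμ x hx => ?_⟩
    · exact Submodule.smul_mem _ r (hE x)
    · rw [LinearMap.smul_apply, hE' μ hμ x hx, smul_zero]

variable {𝕄}

/-- `[L(0), Y(v)_n] = (d - n - 1) Y(v)_n` for `v` of weight `d`. -/
theorem VOA.WeakModule.L_zero_mode {d : ℕ} {v : V} (hv : v ∈ 𝕍.gr d) (n : ℤ) (x : M) :
    mode 𝕄.Y 1 𝕍.conf (mode 𝕄.Y n v x) =
      mode 𝕄.Y n v (mode 𝕄.Y 1 𝕍.conf x) + ((d : ℂ) - n - 1) • mode 𝕄.Y n v x := by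
  have h := 𝕄.borcherds 𝕍.conf v x 1 0 n
  rw [finsum_eq_sum_of_support_subset (s := Finset.range 2),
    finsum_eq_sum_of_support_subset (s := Finset.range 1)] at h
  · have e0 : mode 𝕍.Y 1 𝕍.conf v = (d : ℂ) • v := 𝕍.L_zero d v hv
    simp [Finset.sum_range_succ, 𝕄.L_neg_one, e0] at h
    rw [eq_sub_iff_add_eq] at h
    rw [← h]
    module
  · intro j hj
    by_contra hj'
    have : 0 < j := by simpa [Nat.pos_iff_ne_zero] using hj'
    obtain ⟨i, rfl⟩ : ∃ i, j = i + 1 := ⟨j - 1, by omega⟩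
    apply hj
    simp
  · intro j hj
    by_contra hj'
    obtain ⟨i, rfl⟩ : ∃ i, j = i + 2 := ⟨j - 2, by simp at hj'; omega⟩
    apply hj
    have : Ring.choose (1 : ℤ) (i + 2) = 0 := by
      have := Ring.choose_natCast (R := ℤ) 1 (i + 2)
      simpa [Nat.choose_eq_zero_of_lt (show 1 < i + 2 by omega)] using this
    simp [this]

theorem VOA.WeakModule.mode_mem_weight {d : ℕ} {v : V} (hv : v ∈ 𝕍.gr d) (n : ℤ) {μ : ℂ} {x : M}
    (hx : x ∈ 𝕄.weight μ) : mode 𝕄.Y n v x ∈ 𝕄.weight (μ + ((d : ℂ) - n - 1)) := by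
  have key : ∀ k : ℕ, ∀ y : M,
      ((mode 𝕄.Y 1 𝕍.conf - algebraMap ℂ (Module.End ℂ M) (μ + ((d : ℂ) - n - 1))) ^ k)
        (mode 𝕄.Y n v y) =
      mode 𝕄.Y n v (((mode 𝕄.Y 1 𝕍.conf - algebraMap ℂ (Module.End ℂ M) μ) ^ k) y) := by
    intro k
    induction k with
    | zero => intro y; simp
    | succ k ih =>
      intro y
      rw [pow_succ, pow_succ, Module.End.mul_apply, Module.End.mul_apply, ← ih]
      congr 1
      simp only [LinearMap.sub_apply, Module.algebraMap_end_apply, map_sub, map_smul,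
        L_zero_mode hv, add_smul]
      abel
  rw [weight, Module.End.mem_maxGenEigenspace] at hx ⊢
  obtain ⟨k, hk⟩ := hx
  refine ⟨k, ?_⟩
  have := key k x
  simp only [Algebra.algebraMap_eq_smul_one] at this
  rw [this, hk, map_zero]

variable {A : Subalgebra ℂ (Module.End ℂ M)}

theorem VOA.WeakModule.mode_commute (hA : A ≤ 𝕄.endAlg) {a : Module.End ℂ M} (ha : a ∈ A)
    (n : ℤ) (v : V) : mode 𝕄.Y n v * a = a * mode 𝕄.Y n v :=
  (Subalgebra.mem_centralizer_iff ℂ).1 (hA ha) _ ⟨v, n, rfl⟩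

theorem VOA.WeakModule.mode_mul_mem (hA : A ≤ 𝕄.endAlg) (n : ℤ) (v : V)
    {T : Module.End ℂ M} (hT : T ∈ 𝕄.endZero A) : mode 𝕄.Y n v * T ∈ 𝕄.endZero A := by
  classical
  refine 𝕍.homogeneous_induction (p := fun v => mode 𝕄.Y n v * T ∈ 𝕄.endZero A) v ?_ ?_ ?_
  · intro d v hv
    obtain ⟨hT, E, hE, hE'⟩ := hT
    refine ⟨fun a ha => by rw [mul_assoc, hT a ha, ← mul_assoc, mode_commute hA ha, mul_assoc],
      E ∪ E.image (fun μ => μ + ((d : ℂ) - n - 1)), fun x => ?_, fun μ hμ x hx => ?_⟩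
    · rw [Module.End.mul_apply]
      have hle : (⨆ μ ∈ E, 𝕄.weight μ) ≤
          (⨆ μ ∈ E ∪ E.image (fun μ => μ + ((d : ℂ) - n - 1)), 𝕄.weight μ).comap
            (mode 𝕄.Y n v) := by
        refine iSup₂_le fun μ hμ y hy => ?_
        exact Submodule.mem_iSup_of_mem _ (Submodule.mem_iSup_of_mem
          (Finset.mem_union_right _ (Finset.mem_image_of_mem _ hμ)) (mode_mem_weight hv n hy))
      exact hle (hE x)
    · rw [Module.End.mul_apply, hE' μ (fun h => hμ (Finset.mem_union_left _ h)) x hx, map_zero]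
  · simp
  · intro u v hu hv
    rw [map_add, add_mul]
    exact Submodule.add_mem _ hu hv

theorem VOA.WeakModule.mul_mode_mem (hA : A ≤ 𝕄.endAlg) (n : ℤ) (v : V)
    {T : Module.End ℂ M} (hT : T ∈ 𝕄.endZero A) : T * mode 𝕄.Y n v ∈ 𝕄.endZero A := by
  classical
  refine 𝕍.homogeneous_induction (p := fun v => T * mode 𝕄.Y n v ∈ 𝕄.endZero A) v ?_ ?_ ?_
  · intro d v hv
    obtain ⟨hT, E, hE, hE'⟩ := hT
    refine ⟨fun a ha => by rw [mul_assoc, mode_commute hA ha, ← mul_assoc, hT a ha, mul_assoc],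
      E ∪ E.image (fun μ => μ - ((d : ℂ) - n - 1)), fun x => ?_, fun μ hμ x hx => ?_⟩
    · rw [Module.End.mul_apply]
      exact biSup_mono (f := 𝕄.weight) (fun i hi => Finset.mem_union_left _ hi) (hE _)
    · rw [Module.End.mul_apply]
      refine hE' _ (fun h => hμ (Finset.mem_union_right _ ?_)) _ (mode_mem_weight hv n hx)
      exact Finset.mem_image.2 ⟨_, h, by ring⟩
  · simp
  · intro u v hu hv
    rw [map_add, mul_add]
    exact Submodule.add_mem _ hu hv

theorem VOA.WeakModule.finiteDimensional_range (hM : 𝕄.GradingRestricted)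
    {T : Module.End ℂ M} (hT : T ∈ 𝕄.endZero A) : FiniteDimensional ℂ (LinearMap.range T) := by
  obtain ⟨-, E, hE, -⟩ := hT
  have := hM.finite_weight
  have : FiniteDimensional ℂ ↥(⨆ μ ∈ E, 𝕄.weight μ) := by
    rw [← Finset.sup_eq_iSup]
    exact Submodule.finite_finset_sup E _
  refine Submodule.finiteDimensional_of_le (S₂ := ⨆ μ ∈ E, 𝕄.weight μ) ?_
  rintro _ ⟨x, rfl⟩
  exact hE x

theorem VOA.WeakModule.mode_mul_eventually_zero (hM : 𝕄.GradingRestricted) (v : V)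
    {T : Module.End ℂ M} (hT : T ∈ 𝕄.endZero A) :
    ∃ N : ℤ, ∀ n ≥ N, mode 𝕄.Y n v * T = 0 := by
  have := finiteDimensional_range hM hT
  obtain ⟨s, hs⟩ := (Submodule.fg_iff_finiteDimensional (LinearMap.range T)).2 this
  choose N hN using mode_eventually_zero 𝕄.Y v
  obtain ⟨K, hK⟩ := (s.finite_toSet.image N).bddAbove
  refine ⟨K, fun n hn => ?_⟩
  have hle : LinearMap.range T ≤ LinearMap.ker (mode 𝕄.Y n v) := by
    rw [← hs, Submodule.span_le]
    intro y hy
    exact hN y n (le_trans (hK ⟨y, hy, rfl⟩) hn)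
  ext x
  exact hle ⟨x, rfl⟩

theorem VOA.WeakModule.mul_mode_eventually_zero (hM : 𝕄.GradingRestricted) (v : V)
    {T : Module.End ℂ M} (hT : T ∈ 𝕄.endZero A) :
    ∃ N : ℤ, ∀ n ≤ N, T * mode 𝕄.Y n v = 0 := by
  refine 𝕍.homogeneous_induction (p := fun v => ∃ N : ℤ, ∀ n ≤ N, T * mode 𝕄.Y n v = 0) v ?_ ?_ ?_
  · intro d v hv
    obtain ⟨-, E, -, hE'⟩ := hT
    choose K hK using hM.lower_bounded
    obtain ⟨N, hN⟩ := (E.finite_toSet.image (fun μ => K (μ - d))).bddAbove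
    refine ⟨-(N : ℤ) - 1, fun n hn => ?_⟩
    have hle : (⨆ μ, 𝕄.weight μ) ≤ LinearMap.ker (T * mode 𝕄.Y n v) := by
      refine iSup_le fun μ x hx => ?_
      rw [LinearMap.mem_ker, Module.End.mul_apply]
      have hy := mode_mem_weight hv n hx
      by_cases hmem : μ + ((d : ℂ) - n - 1) ∈ E
      · have h1 := hN ⟨_, hmem, rfl⟩
        obtain ⟨j, hj⟩ : ∃ j : ℕ, n = -(j : ℤ) - 1 := ⟨(-n - 1).toNat, by omega⟩
        have h2 := hK (μ + ((d : ℂ) - n - 1) - d) j (by simp only at h1; omega)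
        have h3 : μ + ((d : ℂ) - n - 1) - d - j = μ := by rw [hj]; push_cast; ring
        rw [h3] at h2
        rw [h2, Submodule.mem_bot] at hx
        rw [hx, map_zero, map_zero]
      · exact hE' _ hmem _ hy
    rw [hM.iSup_weight] at hle
    ext x
    exact hle (Submodule.mem_top (x := x))
  · exact ⟨0, by simp⟩
  · rintro u v ⟨N, hN⟩ ⟨N', hN'⟩
    refine ⟨min N N', fun n hn => ?_⟩
    rw [map_add, mul_add, hN n (le_trans hn (min_le_left _ _)),
      hN' n (le_trans hn (min_le_right _ _)), add_zero]

/-- `T ↦ Y_M(v)_n ∘ T` on `End⁰_A(M)`. -/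
def VOA.WeakModule.leftMode (hA : A ≤ 𝕄.endAlg) (n : ℤ) :
    V →ₗ[ℂ] Module.End ℂ (𝕄.endZero A) :=
  LinearMap.mk₂ ℂ (fun v T => ⟨mode 𝕄.Y n v * T.1, mode_mul_mem hA n v T.2⟩)
    (fun u v T => by ext1; simp [add_mul]) (fun r v T => by ext1; simp)
    (fun v S T => by ext1; simp [mul_add]) (fun r v T => by ext1; simp)

/-- `T ↦ T ∘ Y_M(v)_n` on `End⁰_A(M)`. -/
def VOA.WeakModule.rightMode (hA : A ≤ 𝕄.endAlg) (n : ℤ) :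
    V →ₗ[ℂ] Module.End ℂ (𝕄.endZero A) :=
  LinearMap.mk₂ ℂ (fun v T => ⟨T.1 * mode 𝕄.Y n v, mul_mode_mem hA n v T.2⟩)
    (fun u v T => by ext1; simp [mul_add]) (fun r v T => by ext1; simp)
    (fun v S T => by ext1; simp [add_mul]) (fun r v T => by ext1; simp)

/-- The action `Y(v ⊗ 1, z) T = Y_M(v,z) ∘ T` on `End⁰_A(M)`. -/
def VOA.WeakModule.leftY (hM : 𝕄.GradingRestricted) (hA : A ≤ 𝕄.endAlg) :
    V →ₗ[ℂ] VertexOperator ℂ (𝕄.endZero A) :=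
  ofModes (leftMode hA) (by
    intro v T
    obtain ⟨N, hN⟩ := mode_mul_eventually_zero hM v T.2
    exact ⟨N, fun n hn => Subtype.ext (hN n hn)⟩)

/-- The coefficient of `z^{-n-1}` in `T ↦ T ∘ Y_M(𝒰(γ_z) v, z⁻¹)`, where
`𝒰(γ_z) = e^{zL(1)} (-z^{-2})^{L(0)}`. For `v` of weight `d` we have `L(1)^k v = 0` for `k > d`, so that
`𝒰(γ_z) v = ∑_{k ≤ d} (-1)^d / k! · z^{k-2d} L(1)^k v`, and this coefficient is
`∑_{k ≤ d} (-1)^d / k! · T ∘ Y_M(L(1)^k v)_{2d-k-n-2}`. -/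
def VOA.WeakModule.rightDualMode (hA : A ≤ 𝕄.endAlg) (n : ℤ) :
    V →ₗ[ℂ] Module.End ℂ (𝕄.endZero A) :=
  (DirectSum.toModule ℂ ℕ (Module.End ℂ (𝕄.endZero A)) fun d =>
    (∑ k ∈ Finset.range (d + 1), ((-1 : ℂ) ^ d * (k.factorial : ℂ)⁻¹) •
      (rightMode hA (2 * d - k - n - 2) ∘ₗ (𝕍.L 1) ^ k)) ∘ₗ (𝕍.gr d).subtype) ∘ₗ
    𝕍.decomp.toLinearMap

/-- The action `Y(1 ⊗ v, z) T = T ∘ Y_M(𝒰(γ_z) v, z⁻¹)` on `End⁰_A(M)`. -/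
def VOA.WeakModule.rightY (hM : 𝕄.GradingRestricted) (hA : A ≤ 𝕄.endAlg) :
    V →ₗ[ℂ] VertexOperator ℂ (𝕄.endZero A) :=
  ofModes (rightDualMode hA) (by
    intro v T
    refine 𝕍.homogeneous_induction
      (p := fun v => ∃ N : ℤ, ∀ n ≥ N, rightDualMode hA n v T = 0) v ?_ ?_ ?_
    · intro d v hv
      choose K hK using fun k : ℕ => mul_mode_eventually_zero hM (((𝕍.L 1) ^ k) v) T.2
      obtain ⟨N, hN⟩ := ((Finset.range (d + 1)).finite_toSet.image K).bddBelow
      refine ⟨2 * d - N, fun n hn => ?_⟩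
      simp only [rightDualMode, LinearMap.comp_apply, LinearEquiv.coe_coe, 𝕍.decomp_of_mem hv,
        DirectSum.toModule_lof, Submodule.subtype_apply, LinearMap.sum_apply, LinearMap.smul_apply]
      refine Finset.sum_eq_zero fun k hk => ?_
      have h0 := hK k (2 * d - k - n - 2) (by
        have := hN ⟨k, hk, rfl⟩
        omega)
      have h1 : rightMode hA (2 * d - k - n - 2) (((𝕍.L 1) ^ k) v) T = 0 := Subtype.ext h0
      rw [h1, smul_zero]
    · exact ⟨0, by simp⟩
    · rintro u v ⟨N, hN⟩ ⟨N', hN'⟩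
      refine ⟨max N N', fun n hn => ?_⟩
      rw [map_add, LinearMap.add_apply, hN n (le_trans (le_max_left _ _) hn),
        hN' n (le_trans (le_max_right _ _) hn), add_zero])

end Module

/-! ### The pseudo-trace -/

section PseudoTrace

variable {R : Type*} [Ring R] [Algebra ℂ R] {P : Type*} [AddCommGroup P] [Module R P]

/-- A finite factorization `T = ∑ i, α_i(·) u_i` of an endomorphism `T` of the `R`-module `P`, with
`u_i ∈ P` and `α_i ∈ Hom_R(P, R)`. -/
structure FiniteFactorization (R : Type*) [Ring R] {P : Type*} [AddCommGroup P] [Module R P]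
    (T : P → P) where
  /-- the number of terms -/
  n : ℕ
  /-- the vectors -/
  u : Fin n → P
  /-- the linear forms -/
  form : Fin n → P →ₗ[R] R
  eq : ∀ x, T x = ∑ i, form i x • u i

/-- `∑ i, ω(α_i(u_i))`. -/
def FiniteFactorization.trace {T : P → P} (p : FiniteFactorization R T) (ω : R →ₗ[ℂ] ℂ) : ℂ :=
  ∑ i, ω (p.form i (p.u i))

open Classical in
/-- The pseudo-trace (Hattori-Stallings trace) attached to the symmetric linear functional `ω` on `R`:
`Tr^ω T = ∑ i, ω(α_i(u_i))` for any finite factorization `T = ∑ i, α_i(·) u_i`. For projective `P` this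
does not depend on the factorization (`FiniteFactorization.trace_eq`). In particular, if `P` is finitely
generated projective with coordinate system `(m_i, α_i)`, i.e. `x = ∑ i, α_i(x) m_i` for all `x`, then
`Tr^ω T = ∑ i, ω(α_i(T m_i))`; and if `Q` is a direct summand of `P`, then the pseudo-trace of an
endomorphism of `Q`, extended by zero to `P`, is its pseudo-trace on `Q`. -/
def pseudoTraceFun (ω : R →ₗ[ℂ] ℂ) (T : P → P) : ℂ :=
  if h : Nonempty (FiniteFactorization R T) then h.some.trace ω else 0

theorem FiniteFactorization.trace_eq_finsum {T : P → P} (p : FiniteFactorization R T)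
    (ω : R →ₗ[ℂ] ℂ) (hω : ∀ a b, ω (a * b) = ω (b * a)) (s : P →ₗ[R] (P →₀ R))
    (hs : ∀ x, Finsupp.linearCombination R id (s x) = x) :
    p.trace ω = ∑ᶠ m : P, ω (s (T m) m) := by
  classical
  set J : Finset P := Finset.univ.biUnion fun i => (s (p.u i)).support with hJ
  have hsub : ∀ i, (s (p.u i)).support ⊆ J := fun i =>
    Finset.subset_biUnion_of_mem (fun i => (s (p.u i)).support) (Finset.mem_univ i)
  have hT : ∀ m x, s (T m) x = ∑ i, p.form i m * s (p.u i) x := by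
    intro m x
    rw [p.eq, map_sum, Finsupp.finsetSum_apply]
    simp
  rw [finsum_eq_sum_of_support_subset (s := J)]
  · simp only [hT, map_sum, FiniteFactorization.trace]
    rw [Finset.sum_comm]
    refine Finset.sum_congr rfl fun i _ => ?_
    conv_lhs => rw [← hs (p.u i), Finsupp.linearCombination_apply,
      Finsupp.sum_of_support_subset _ (hsub i) _ (by simp)]
    rw [map_sum, map_sum]
    refine Finset.sum_congr rfl fun m _ => ?_
    rw [map_smul, smul_eq_mul, id, hω]
  · intro m hm
    by_contra hmJ
    refine hm ?_
    simp only [hT]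
    rw [Finset.sum_eq_zero, map_zero]
    intro i _
    have : m ∉ (s (p.u i)).support := fun h => hmJ (hsub i h)
    rw [Finsupp.notMem_support_iff.1 this, mul_zero]

theorem FiniteFactorization.trace_eq [Module.Projective R P] {T : P → P}
    (p q : FiniteFactorization R T) (ω : R →ₗ[ℂ] ℂ) (hω : ∀ a b, ω (a * b) = ω (b * a)) :
    p.trace ω = q.trace ω := by
  obtain ⟨s, hs⟩ := Module.projective_def.1 (inferInstance : Module.Projective R P)
  rw [p.trace_eq_finsum ω hω s hs, q.trace_eq_finsum ω hω s hs]

theorem pseudoTraceFun_eq [Module.Projective R P] {T : P → P}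
    (p : FiniteFactorization R T) (ω : R →ₗ[ℂ] ℂ) (hω : ∀ a b, ω (a * b) = ω (b * a)) :
    pseudoTraceFun ω T = p.trace ω := by
  rw [pseudoTraceFun, dif_pos ⟨p⟩]
  exact FiniteFactorization.trace_eq _ _ ω hω

theorem pseudoTraceFun_add [Module.Projective R P] {S T : P → P}
    (p : FiniteFactorization R S) (q : FiniteFactorization R T) (ω : R →ₗ[ℂ] ℂ)
    (hω : ∀ a b, ω (a * b) = ω (b * a)) :
    pseudoTraceFun ω (fun x => S x + T x) = pseudoTraceFun ω S + pseudoTraceFun ω T := by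
  rw [pseudoTraceFun_eq p ω hω, pseudoTraceFun_eq q ω hω,
    pseudoTraceFun_eq ⟨p.n + q.n, Fin.append p.u q.u, Fin.append p.form q.form, fun x => by
      rw [p.eq, q.eq, Fin.sum_univ_add]; simp⟩ ω hω]
  simp [FiniteFactorization.trace, Fin.sum_univ_add]

theorem pseudoTraceFun_smul [Module.Projective R P] [Module ℂ P] [IsScalarTower ℂ R P] (r : ℂ)
    {T : P → P} (p : FiniteFactorization R T) (ω : R →ₗ[ℂ] ℂ)
    (hω : ∀ a b, ω (a * b) = ω (b * a)) :
    pseudoTraceFun ω (fun x => r • T x) = r * pseudoTraceFun ω T := by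
  have h : ∀ (a : R) (x : P), r • (a • x) = a • (r • x) := fun a x => by
    rw [← algebraMap_smul R r (a • x), ← algebraMap_smul R r x, smul_smul, smul_smul,
      Algebra.commutes]
  have h2 : ∀ x : P, r • x = (algebraMap ℂ R r) • x := fun x => (algebraMap_smul R r x).symm
  rw [pseudoTraceFun_eq p ω hω,
    pseudoTraceFun_eq ⟨p.n, fun i => r • p.u i, p.form, fun x => by
      rw [p.eq, Finset.smul_sum]; exact Finset.sum_congr rfl fun i _ => h _ _⟩ ω hω]
  simp only [FiniteFactorization.trace, Finset.mul_sum]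
  refine Finset.sum_congr rfl fun i _ => ?_
  rw [h2, map_smul, smul_eq_mul, ← Algebra.smul_def, map_smul, smul_eq_mul]

end PseudoTrace

section Module

variable {V : Type*} [AddCommGroup V] [Module ℂ V] {𝕍 : VOA V}
  {M : Type*} [AddCommGroup M] [Module ℂ M] {𝕄 : 𝕍.WeakModule M}
  {A : Subalgebra ℂ (Module.End ℂ M)}

theorem VOA.WeakModule.nonempty_factorization (hM : 𝕄.GradingRestricted) [Module.Projective A M]
    {T : Module.End ℂ M} (hT : T ∈ 𝕄.endZero A) : Nonempty (FiniteFactorization A T) := by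
  classical
  have := finiteDimensional_range hM hT
  obtain ⟨b, hb⟩ := (Submodule.fg_iff_finiteDimensional (LinearMap.range T)).2 this
  obtain ⟨s, hs⟩ := Module.projective_def.1 (inferInstance : Module.Projective A M)
  set J : Finset M := b.biUnion fun y => (s y).support with hJ
  have hsub : ∀ x, (s (T x)).support ⊆ J := by
    intro x m hm
    by_contra hmJ
    have hle : LinearMap.range T ≤
        LinearMap.ker ((Finsupp.lapply m ∘ₗ s : M →ₗ[A] A).restrictScalars ℂ) := by
      rw [← hb, Submodule.span_le]
      intro y hy
      have : m ∉ (s y).support := fun h => hmJ (Finset.mem_biUnion.2 ⟨y, hy, h⟩)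
      exact Finsupp.notMem_support_iff.1 this
    exact (Finsupp.mem_support_iff.1 hm) (hle ⟨x, rfl⟩)
  let TA : M →ₗ[A] M :=
    { toFun := T
      map_add' := T.map_add
      map_smul' := fun a x => congrFun (congrArg DFunLike.coe (hT.1 a.1 a.2)) x }
  refine ⟨J.card, fun i => (J.equivFin.symm i : M),
    fun i => Finsupp.lapply (J.equivFin.symm i : M) ∘ₗ s ∘ₗ TA, fun x => ?_⟩
  conv_lhs => rw [← hs (T x), Finsupp.linearCombination_apply,
    Finsupp.sum_of_support_subset _ (hsub x) _ (by simp)]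
  rw [← Finset.sum_coe_sort, ← J.equivFin.symm.sum_comp]
  rfl

/-- The pseudo-trace `Tr^ω : End⁰_A(M) → ℂ` of the symmetric linear functional `ω` on `A`. -/
def VOA.WeakModule.pseudoTrace (hM : 𝕄.GradingRestricted) [Module.Projective A M]
    (ω : A →ₗ[ℂ] ℂ) (hω : ∀ a b, ω (a * b) = ω (b * a)) : 𝕄.endZero A →ₗ[ℂ] ℂ where
  toFun T := pseudoTraceFun ω T.1
  map_add' S T := by
    obtain ⟨p⟩ := nonempty_factorization hM S.2
    obtain ⟨q⟩ := nonempty_factorization hM T.2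
    exact pseudoTraceFun_add p q ω hω
  map_smul' r T := by
    obtain ⟨p⟩ := nonempty_factorization hM T.2
    exact pseudoTraceFun_smul r p ω hω

end Module

/-! ### Conformal blocks on the constant family `(ℙ¹ × B → B | ∞, 0; 1/z, z)`

The total space `ℙ¹ × B` is covered by the two charts `ℂ × B` with fibre coordinates `z` and `t = 1/z`. -/

section ConformalBlock

/-- The space `𝒪(X)` of holomorphic functions on a complex manifold `X`. -/
def holomorphicFunctions {E : Type*} [NormedAddCommGroup E] [NormedSpace ℂ E] (X : Type*)
    [TopologicalSpace X] [ChartedSpace E X] : Subalgebra ℂ (X → ℂ) where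
  carrier := {f | MDifferentiable 𝓘(ℂ, E) 𝓘(ℂ, ℂ) f}
  mul_mem' hf hg := MDifferentiable.mul hf hg
  add_mem' hf hg := MDifferentiable.add hf hg
  algebraMap_mem' _ := mdifferentiable_const

/-- `f` is on the open set `U` a section of `W ⊗ 𝒪_X`: locally a finite sum `∑ i, g_i w_i` with `g_i`
holomorphic scalar functions and `w_i ∈ W`. For `W = V = ⨁ V(n)` these are the sections of
`lim V^{≤ n} ⊗ 𝒪_X`. -/
def IsSectionOn {E H : Type*} [NormedAddCommGroup E] [NormedSpace ℂ E] [TopologicalSpace H]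
    (I : ModelWithCorners ℂ E H) {X : Type*} [TopologicalSpace X] [ChartedSpace H X]
    {W : Type*} [AddCommGroup W] [Module ℂ W] (f : X → W) (U : Set X) : Prop :=
  ∀ p ∈ U, ∃ O : Set X, IsOpen O ∧ p ∈ O ∧ ∃ (n : ℕ) (g : Fin n → X → ℂ) (w : Fin n → W),
    (∀ i, MDifferentiableOn I 𝓘(ℂ, ℂ) (g i) O) ∧ ∀ q ∈ O ∩ U, f q = ∑ i, g i q • w i

variable {V : Type*} [AddCommGroup V] [Module ℂ V]
  {E : Type*} [NormedAddCommGroup E] [NormedSpace ℂ E]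
  {B : Type*} [TopologicalSpace B] [ChartedSpace E B]

/-- In the chart `ℂ × D` with fibre coordinate `ζ`: `σ` is a section of `V ⊗ 𝒪` over `ζ ≠ 0` with poles
of finite order along `ζ = 0` (locally over `D`). -/
structure IsMeromorphicSection (D : Set B) (σ : ℂ × B → V) : Prop where
  holomorphic : IsSectionOn (𝓘(ℂ, ℂ).prod 𝓘(ℂ, E)) σ {p | p.1 ≠ 0 ∧ p.2 ∈ D}
  finite_poles : ∀ b ∈ D, ∃ O : Set (ℂ × B), IsOpen O ∧ ((0 : ℂ), b) ∈ O ∧ ∃ (k : ℕ) (τ : ℂ × B → V),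
    IsSectionOn (𝓘(ℂ, ℂ).prod 𝓘(ℂ, E)) τ O ∧ ∀ p ∈ O, p.1 ≠ 0 → p.2 ∈ D → p.1 ^ k • σ p = τ p

/-- A section over `ℙ¹ × D` of `𝒱 ⊗ ω(•S)`, where `𝒱` is the sheaf of vertex operator algebras of the
family, `ω` the relative dualizing sheaf and `S` the divisor of the marked points `∞, 0`. It is given by
`σzero dz` in the trivialization of `𝒱` by the coordinate `z`, and by `σinf dt` in the trivialization by
`t = 1/z`. The transition function of `𝒱` from the first to the second trivialization at the point `z` is
`𝒰(γ_z)`, and `dt = γ_z'(0) dz`. -/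
structure IsSphereSection (𝕍 : VOA V) (D : Set B) (σinf σzero : ℂ × B → V) : Prop where
  zero : IsMeromorphicSection (E := E) D σzero
  inf : IsMeromorphicSection (E := E) D σinf
  transition : ∀ b ∈ D, ∀ z : ℂ, z ≠ 0 →
    PowerSeries.coeff 1 (gammaSeries z) • σinf (z⁻¹, b) =
      𝕍.changeOfCoord (gammaSeries z) (σzero (z, b))

/-- `r` is the residue at `ζ = 0` of `Y(f(ζ), ζ) w dζ`, where `f` is a `V`-valued function with a finite
pole at `0`: if `f(ζ) = ζ^{-k} ∑ l, g_l(ζ) v_l` near `0` with holomorphic `g_l(ζ) = ∑ g_{l,m} ζ^m`, then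
the residue is `∑ l, ∑ m, g_{l,m} Y(v_l)_{m-k} w` (a finite sum). -/
def IsResidue {W : Type*} [AddCommGroup W] [Module ℂ W] (Y : V →ₗ[ℂ] VertexOperator ℂ W)
    (f : ℂ → V) (w r : W) : Prop :=
  ∃ (k n : ℕ) (g : Fin n → ℂ → ℂ) (v : Fin n → V), (∀ l, AnalyticAt ℂ (g l) 0) ∧
    (∀ᶠ ζ in 𝓝[≠] (0 : ℂ), ζ ^ k • f ζ = ∑ l, g l ζ • v l) ∧
    r = ∑ l, ∑ᶠ m : ℕ, (iteratedDeriv m (g l) 0 / m.factorial) • mode Y ((m : ℤ) - k) (v l) w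

open Classical in
/-- The residue `Res_{ζ=0} Y(f(ζ), ζ) w dζ` of a function `f` with a finite pole at `0`. -/
def residue {W : Type*} [AddCommGroup W] [Module ℂ W] (Y : V →ₗ[ℂ] VertexOperator ℂ W)
    (f : ℂ → V) (w : W) : W :=
  if h : ∃ r, IsResidue Y f w r then h.choose else 0

/-- `Φ` is a conformal block, i.e. an element of `H⁰(B, 𝒯*(W))`, for the family
`(ℙ¹ × B → B | ∞, 0; 1/z, z)` and the space `W` on which `V` acts by `Yinf` (associated to `∞`) and by
`Yzero` (associated to `0`). The sheaf `𝒲(W)` is identified with `W ⊗ 𝒪_B` by means of the local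
coordinates, so that `Φ` is the `𝒪_B`-linear map sending `∑ j, f_j w_j` to `∑ j, f_j Φ(w_j)`. It has
to vanish on `σ · w`, the sum of the two residue actions, for all sections `σ` of `𝒱 ⊗ ω(•S)` over
`ℙ¹ × D` and `w` of `W ⊗ 𝒪_B` over `D`, where `D` is any open subset of `B`. -/
def IsConformalBlock (𝕍 : VOA V) {W : Type*} [AddCommGroup W] [Module ℂ W]
    (Yinf Yzero : V →ₗ[ℂ] VertexOperator ℂ W)
    (Φ : W →ₗ[ℂ] holomorphicFunctions (E := E) B) : Prop :=
  ∀ (D : Set B), IsOpen D → ∀ σinf σzero : ℂ × B → V, IsSphereSection (E := E) 𝕍 D σinf σzero →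
    ∀ w : B → W, IsSectionOn 𝓘(ℂ, E) w D → ∀ b ∈ D,
      (Φ (residue Yinf (fun t => σinf (t, b)) (w b) +
        residue Yzero (fun z => σzero (z, b)) (w b)) : B → ℂ) b = 0

end ConformalBlock

end PseudoTraceBlock

end

noncomputable section

namespace PseudoTraceBlock

/-! ### Contour integrals -/

section Contour

open Complex

/-! The argument combines cyclicity of the pseudo-trace with the residue theorem on `ℙ¹`, one fibre
at a time.

Cyclicity: write `T = ∑ α_i(·) u_i`. Since `A` commutes with the modes, `y = Y_M(v)_n` is
`A`-linear, so `y ∘ T` and `T ∘ y` factor through `(y u_i, α_i)` and `(u_i, α_i ∘ y)`. Both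
factorizations have trace `∑ ω(α_i(y u_i))`, and by projectivity and the symmetry of `ω` the trace
does not depend on the factorization (`pseudoTrace_leftMode`).

Consequently `ψ_n(v) = Tr^ω(Y_M(v)_n T)` vanishes for `n ≫ 0` (read on the left of `T`) and for `n ≪
0` (read on the right), so `∑ ψ_n(v) t^{-n-1}` is a Laurent polynomial in the coordinate `t = 1/z`.
Rewriting the action at `0` by cyclicity gives the same correlation function, with `v` replaced by
`𝒰(γ_z) v` and `t` by `z⁻¹` (`IsDualFamily.modeSum_eq`). As `𝒰(γ_z)` is also the transition function
of `𝒱`, pairing with a section `σ` yields a single 1-form on the sphere, holomorphic off `0` and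
`∞`. The two residue actions are its two residues, which add up to zero (`residue_sphere`). -/

/-- The integral of `z ^ (-j - 1) g(z)` over a small circle is `2πi` times the `j`-th Taylor
coefficient of `g`. -/
theorem eventually_circleIntegral_zpow_mul {g : ℂ → ℂ} (hg : AnalyticAt ℂ g 0) (j : ℤ) :
    ∀ᶠ R : ℝ in 𝓝[>] 0, CircleIntegrable (fun z => z ^ (-j - 1) * g z) 0 R ∧
      (∮ z in C(0, R), z ^ (-j - 1) * g z) =
        2 * Real.pi * I * if 0 ≤ j then
          iteratedDeriv j.toNat g 0 / (j.toNat.factorial : ℂ) else 0 := by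
  obtain ⟨ε, hε, hball⟩ := Metric.eventually_nhds_iff_ball.1 hg.eventually_analyticAt
  filter_upwards [Ioo_mem_nhdsGT hε] with R hR
  have hsub : Metric.closedBall (0 : ℂ) R ⊆ Metric.ball 0 ε :=
    Metric.closedBall_subset_ball hR.2
  have hdiff : DifferentiableOn ℂ g (Metric.closedBall 0 R) := fun z hz =>
    (hball z (hsub hz)).differentiableAt.differentiableWithinAt
  refine ⟨?_, ?_⟩
  · refine ContinuousOn.circleIntegrable hR.1.le fun z hz => ?_
    have hz0 : z ≠ 0 := by
      rintro rfl
      simp at hz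
      exact hR.1.ne' hz.symm
    exact ((continuousAt_zpow₀ z _ (Or.inl hz0)).mul
      (hball z (hsub (Metric.sphere_subset_closedBall hz))).continuousAt).continuousWithinAt
  · split_ifs with hj
    · obtain ⟨n, rfl⟩ := Int.eq_ofNat_of_zero_le hj
      have h := hdiff.circleIntegral_one_div_sub_center_pow_smul hR.1 n
      have e : ∀ z : ℂ, z ^ (-(n : ℤ) - 1) * g z = (1 / (z - 0) ^ (n + 1)) • g z := by
        intro z
        rw [show -(n : ℤ) - 1 = -((n + 1 : ℕ) : ℤ) by push_cast; ring, zpow_neg, zpow_natCast]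
        simp
      simp only [e]
      rw [h]
      simp only [smul_eq_mul, Int.toNat_natCast]
      ring
    -- For `j < 0` the exponent is a natural number, so the integrand is holomorphic and Cauchy's
    -- theorem applies.
    · obtain ⟨n, hn⟩ : ∃ n : ℕ, -j - 1 = n := ⟨(-j - 1).toNat, by omega⟩
      simp only [hn, zpow_natCast, mul_zero]
      refine circleIntegral_eq_zero_of_differentiable_on_off_countable hR.1.le
        Set.countable_empty ?_ ?_
      · exact (continuous_pow n).continuousOn.mul hdiff.continuousOn
      · intro z hz
        exact (differentiableAt_pow n).mul
          (hball z (hsub (Metric.ball_subset_closedBall hz.1))).differentiableAt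

/-- Change of variable `z ↦ 1/z` in a contour integral. -/
theorem circleIntegral_comp_inv {R : ℝ} (hR : 0 < R) (k : ℂ → ℂ) :
    (∮ t in C(0, R), k t) = ∮ z in C(0, R⁻¹), z ^ (-2 : ℤ) * k z⁻¹ := by
  have hR0 : (R : ℂ) ≠ 0 := by exact_mod_cast hR.ne'
  simp only [circleIntegral, deriv_circleMap, smul_eq_mul]
  have h := intervalIntegral.integral_comp_sub_left (a := 0) (b := 2 * Real.pi)
    (fun θ : ℝ => circleMap 0 R⁻¹ θ * I *
      (circleMap 0 R⁻¹ θ ^ (-2 : ℤ) * k (circleMap 0 R⁻¹ θ)⁻¹)) (2 * Real.pi)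
  rw [sub_self, sub_zero] at h
  rw [← h]
  refine intervalIntegral.integral_congr fun θ _ => ?_
  -- Inversion sends the angle `θ` to `2π - θ`. This reversal of orientation cancels the sign of `dt
  -- = -z^{-2} dz`, so the formula carries `+z^{-2}`.
  have e : circleMap 0 R⁻¹ (2 * Real.pi - θ) = (circleMap 0 R θ)⁻¹ := by
    simp only [circleMap, zero_add, mul_inv, ofReal_inv, ← Complex.exp_neg]
    congr 1
    rw [Complex.exp_eq_exp_iff_exists_int]
    exact ⟨1, by push_cast; ring⟩
  have hne : circleMap 0 R θ ≠ 0 := circleMap_ne_center hR.ne'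
  simp only [e, inv_inv]
  rw [inv_zpow, zpow_neg, inv_inv]
  field_simp

/-- The residue theorem on the sphere for a function with at most two poles, at `0` and `∞`. -/
theorem residue_sphere {h k : ℂ → ℂ} {r s : ℂ} (hd : ∀ z ≠ 0, DifferentiableAt ℂ h z)
    (hk : ∀ z ≠ 0, h z = - (z ^ (-2 : ℤ) * k z⁻¹))
    (hr : ∀ᶠ R : ℝ in 𝓝[>] 0, (∮ z in C(0, R), h z) = 2 * Real.pi * I * r)
    (hs : ∀ᶠ R : ℝ in 𝓝[>] 0, (∮ z in C(0, R), k z) = 2 * Real.pi * I * s) : s + r = 0 := by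
  -- One radius `R < 1` serves both points: the circle of radius `R` around `∞` is the circle `|z| =
  -- R⁻¹`, and the form is holomorphic on the annulus in between.
  obtain ⟨R, ⟨hR, hR'⟩, hR0, hR1⟩ := ((hr.and hs).and (Ioo_mem_nhdsGT one_pos)).exists
  have h1 : R ≤ R⁻¹ := hR1.le.trans ((one_le_inv₀ hR0).2 hR1.le)
  have hann := circleIntegral_eq_of_differentiable_on_annulus_off_countable (c := 0) hR0 h1 (f := h)
    Set.countable_empty
    (fun z hz => (hd z (by rintro rfl; simp [hR0] at hz)).continuousAt.continuousWithinAt)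
    (fun z hz => hd z (by rintro rfl; simp [hR0.le] at hz))
  have hsum : (∮ z in C(0, R⁻¹), h z) = - ∮ t in C(0, R), k t := by
    rw [circleIntegral_comp_inv hR0, neg_eq_neg_one_mul, ← circleIntegral.integral_const_mul]
    refine circleIntegral.integral_congr (inv_nonneg.2 hR0.le) fun z hz => ?_
    have hz0 : z ≠ 0 := by
      rintro rfl
      simp at hz
      exact hR0.ne hz
    simp only [hk z hz0]
    ring
  rw [hann, hR, hR'] at hsum
  have h2 : (2 * Real.pi * I : ℂ) ≠ 0 := two_pi_I_ne_zero
  have : (2 * Real.pi * I : ℂ) * (s + r) = 0 := by rw [mul_add, hsum]; ring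
  exact (mul_eq_zero.1 this).resolve_left h2

end Contour

/-! ### Correlation functions with finitely many modes -/

section ModeSum

variable {V : Type*} [AddCommGroup V] [Module ℂ V]

/-- The Laurent polynomial `∑ n, ψ_n(v) z^{-n-1}` attached to a family of linear functionals `ψ_n`,
almost all of which vanish on each vector. -/
def modeSum (ψ : ℤ → V →ₗ[ℂ] ℂ) (hψ : ∀ v, (Function.support fun n => ψ n v).Finite) (z : ℂ) :
    V →ₗ[ℂ] ℂ :=
  Finsupp.linearCombination ℂ (fun n : ℤ => z ^ (-n - 1)) ∘ₗ
    { toFun := fun v => Finsupp.ofSupportFinite (fun n => ψ n v) (hψ v)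
      map_add' := fun u v => by ext n; simp [Finsupp.ofSupportFinite_coe]
      map_smul' := fun r v => by ext n; simp [Finsupp.ofSupportFinite_coe] }

variable {ψ : ℤ → V →ₗ[ℂ] ℂ} {hψ : ∀ v, (Function.support fun n => ψ n v).Finite}

theorem modeSum_eq_sum (z : ℂ) (v : V) :
    modeSum ψ hψ z v = ∑ n ∈ (hψ v).toFinset, ψ n v * z ^ (-n - 1) := by
  simp only [modeSum, LinearMap.comp_apply, Finsupp.linearCombination_apply]
  rw [Finsupp.sum_of_support_subset (s := (hψ v).toFinset) _ _ _ (by simp)]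
  · rfl
  · exact fun n hn => (hψ v).mem_toFinset.2 (Finsupp.mem_support_iff.1 hn)

theorem modeSum_eq_finsum (z : ℂ) (v : V) :
    modeSum ψ hψ z v = ∑ᶠ n : ℤ, ψ n v * z ^ (-n - 1) := by
  rw [modeSum_eq_sum, finsum_eq_sum_of_support_subset]
  intro n hn
  simpa using left_ne_zero_of_mul hn

theorem differentiableAt_modeSum (v : V) {z : ℂ} (hz : z ≠ 0) :
    DifferentiableAt ℂ (fun z => modeSum ψ hψ z v) z := by
  simp only [modeSum_eq_sum]
  exact DifferentiableAt.fun_sum fun n _ =>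
    (differentiableAt_zpow.2 (Or.inl hz)).const_mul _

/-- The residue of `Y(f(ζ), ζ) w dζ`, paired with a linear functional `Φ`, is a contour integral. -/
theorem IsResidue.eventually_circleIntegral {W : Type*} [AddCommGroup W] [Module ℂ W]
    {Y : V →ₗ[ℂ] VertexOperator ℂ W} {f : ℂ → V} {w r : W} (h : IsResidue Y f w r)
    (Φ : W →ₗ[ℂ] ℂ) (hΦ : ∀ n v, Φ (mode Y n v w) = ψ n v) :
    ∀ᶠ R : ℝ in 𝓝[>] 0, (∮ z in C(0, R), modeSum ψ hψ z (f z)) =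
      2 * Real.pi * Complex.I * Φ r := by
  obtain ⟨k, N, g, v, hg, hf, rfl⟩ := h
  -- Only finitely many pairs `(l, n)` occur, so one small radius works for all of them. The shift
  -- `n + k` absorbs the pole factor `z^{-k}` of `f`.
  have hint : ∀ᶠ R : ℝ in 𝓝[>] 0, ∀ l : Fin N, ∀ n ∈ (hψ (v l)).toFinset, _ :=
    Filter.eventually_all.2 fun l => (Filter.eventually_all_finset _).2 fun n _ =>
      eventually_circleIntegral_zpow_mul (hg l) (n + k)
  obtain ⟨ε, hε, hball⟩ := Metric.eventually_nhds_iff_ball.1 (eventually_nhdsWithin_iff.1 hf)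
  filter_upwards [hint, Ioo_mem_nhdsGT hε] with R hR hRε
  have hR0 := hRε.1
  have hcongr : (∮ z in C(0, R), modeSum ψ hψ z (f z)) =
      ∮ z in C(0, R), ∑ l, ∑ n ∈ (hψ (v l)).toFinset,
        ψ n (v l) * (z ^ (-(n + k : ℤ) - 1) * g l z) := by
    refine circleIntegral.integral_congr hR0.le fun z hz => ?_
    have hnorm : ‖z‖ = R := by simpa using hz
    have hz0 : z ≠ 0 := by
      rintro rfl
      rw [norm_zero] at hnorm
      exact hR0.ne hnorm
    have h1 := hball z (by simpa [hnorm] using hRε.2) hz0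
    have h2 : f z = (z ^ k)⁻¹ • ∑ l, g l z • v l := by
      rw [← h1, smul_smul, inv_mul_cancel₀ (pow_ne_zero k hz0), one_smul]
    simp only [h2, map_smul, map_sum, smul_eq_mul, Finset.mul_sum]
    refine Finset.sum_congr rfl fun l _ => ?_
    rw [modeSum_eq_sum, Finset.mul_sum, Finset.mul_sum]
    refine Finset.sum_congr rfl fun n _ => ?_
    rw [show -(n + k : ℤ) - 1 = (-n - 1) + -(k : ℤ) by ring, zpow_add₀ hz0, zpow_neg, zpow_natCast]
    ring
  have hI : ∀ l, ∀ n ∈ (hψ (v l)).toFinset,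
      CircleIntegrable (fun z => ψ n (v l) * (z ^ (-(n + k : ℤ) - 1) * g l z)) 0 R := fun l n hn =>
    (hR l n hn).1.const_smul (a := ψ n (v l))
  rw [hcongr, circleIntegral.integral_fun_sum, map_sum, Finset.mul_sum]
  · refine Finset.sum_congr rfl fun l _ => ?_
    rw [circleIntegral.integral_fun_sum (hI l)]
    have hfin : (Function.support fun m : ℕ =>
        (iteratedDeriv m (g l) 0 / m.factorial) • mode Y ((m : ℤ) - k) (v l) w).Finite := by
      obtain ⟨K, hK⟩ := mode_eventually_zero Y (v l) w
      refine (Set.finite_Iio (K + k).toNat).subset fun m hm => ?_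
      by_contra hlt
      refine hm ?_
      simp only [Set.mem_Iio, not_lt] at hlt
      simp only [hK _ (show (m : ℤ) - k ≥ K by omega), smul_zero]
    rw [map_finsum Φ hfin]
    simp only [map_smul, hΦ, smul_eq_mul]
    -- The residue is indexed by the Taylor order `m ∈ ℕ`, the contour integral by the mode `n ∈ ℤ`.
    -- They match under `n = m - k`, since `F` is zero where `n + k < 0`.
    let F : ℤ → ℂ := fun n => ψ n (v l) * if 0 ≤ n + k then
          iteratedDeriv (n + k).toNat (g l) 0 / ((n + k).toNat.factorial : ℂ) else 0
    have e1 : ∑ᶠ m : ℕ, iteratedDeriv m (g l) 0 / (m.factorial : ℂ) * ψ ((m : ℤ) - k) (v l) =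
        ∑ᶠ n : ℤ, F n := by
      have hinj : Function.Injective fun m : ℕ => (m : ℤ) - k := fun a b hab => by
        simp only at hab; omega
      have hsupp : Function.support F ⊆ Set.range fun m : ℕ => (m : ℤ) - k := by
        intro n hn
        have : 0 ≤ n + k := by
          by_contra hneg
          exact hn (by simp only [F, if_neg hneg, mul_zero])
        exact ⟨(n + k).toNat, by simp only; omega⟩
      rw [← finsum_mem_univ F, ← finsum_mem_inter_support F Set.univ,
        Set.univ_inter, ← Set.inter_eq_right.2 hsupp, finsum_mem_inter_support,
        finsum_mem_range hinj]
      refine finsum_congr fun m => ?_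
      simp [F, mul_comm]
    rw [e1, finsum_eq_sum_of_support_subset (s := (hψ (v l)).toFinset), Finset.mul_sum]
    · refine Finset.sum_congr rfl fun n hn => ?_
      rw [circleIntegral.integral_const_mul, (hR l n hn).2]
      simp only [F]
      ring
    · intro n hn
      simpa using left_ne_zero_of_mul hn
  · exact fun l _ => CircleIntegrable.fun_sum _ (hI l)

end ModeSum

end PseudoTraceBlock

end

noncomputable section

namespace PseudoTraceBlock

/-! ### The operators `𝒰(γ_z)` -/

section Gamma

variable {V : Type*} [AddCommGroup V] [Module ℂ V] (𝕍 : VOA V)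

/-! ### Eigenvectors of `L(0)` and local nilpotency of `L(1)` -/

theorem VOA.decomp_L_zero (v : V) (e : ℕ) : 𝕍.decomp (𝕍.L 0 v) e = (e : ℂ) • 𝕍.decomp v e := by
  refine 𝕍.homogeneous_induction
    (p := fun v => 𝕍.decomp (𝕍.L 0 v) e = (e : ℂ) • 𝕍.decomp v e) v ?_ ?_ ?_
  · intro d v hv
    have h0 : 𝕍.L 0 v = (d : ℂ) • v := 𝕍.L_zero d v hv
    rw [h0, map_smul, DirectSum.smul_apply, 𝕍.decomp_of_mem hv]
    by_cases hde : d = e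
    · subst hde; rfl
    · rw [DirectSum.lof_eq_of, DirectSum.of_eq_of_ne _ _ _ (Ne.symm hde), smul_zero, smul_zero]
  · simp
  · intro u v hu hv
    rw [map_add, map_add, map_add, DirectSum.add_apply, DirectSum.add_apply, hu, hv, smul_add]

theorem VOA.decomp_symm_apply (x : DirectSum ℕ fun d => 𝕍.gr d) :
    𝕍.decomp.symm x = DirectSum.coeLinearMap 𝕍.gr x := by
  simp [VOA.decomp]

/-- The component of weight `e` is multiplied by `e` and by `d`, hence vanishes unless `e = d`. -/
theorem VOA.mem_gr_of_L_zero {v : V} {d : ℕ} (h : 𝕍.L 0 v = (d : ℂ) • v) : v ∈ 𝕍.gr d := by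
  have h1 : ∀ e, e ≠ d → 𝕍.decomp v e = 0 := by
    intro e he
    have h2 := 𝕍.decomp_L_zero v e
    rw [h, map_smul, DirectSum.smul_apply, ← sub_eq_zero, ← sub_smul] at h2
    refine (smul_eq_zero.1 h2).resolve_left (sub_ne_zero.2 ?_)
    exact_mod_cast he.symm
  have h3 : 𝕍.decomp v = DirectSum.lof ℂ ℕ (fun d => 𝕍.gr d) d (𝕍.decomp v d) := by
    ext e
    by_cases he : e = d
    · rw [he, DirectSum.lof_apply]
    · rw [h1 e he, DirectSum.lof_eq_of, DirectSum.of_eq_of_ne _ _ _ he]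
  rw [← 𝕍.decomp.symm_apply_apply v, h3, decomp_symm_apply, DirectSum.coeLinearMap_lof]
  exact (𝕍.decomp v d).2

/-- All weights are natural numbers, so `-1` is no eigenvalue. This is what makes `L(1)` vanish on
`V(0)`. -/
theorem VOA.eq_zero_of_L_zero {v : V} (h : 𝕍.L 0 v = (-1 : ℂ) • v) : v = 0 := by
  refine (map_eq_zero_iff 𝕍.decomp 𝕍.decomp.injective).1 (DFinsupp.ext fun e => ?_)
  have h2 := 𝕍.decomp_L_zero v e
  rw [h, map_smul, DirectSum.smul_apply, ← sub_eq_zero, ← sub_smul] at h2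
  refine (smul_eq_zero.1 h2).resolve_left fun h3 => ?_
  have h4 : ((e + 1 : ℕ) : ℂ) = 0 := by push_cast; linear_combination -h3
  exact Nat.cast_ne_zero.2 e.succ_ne_zero h4

/-- This is `[L(0), L(1)] = -L(1)`; there is no central term because `0 + 1 ≠ 0`. -/
theorem VOA.L_zero_L_one {v : V} {d : ℕ} (hv : v ∈ 𝕍.gr d) :
    𝕍.L 0 (𝕍.L 1 v) = ((d : ℂ) - 1) • 𝕍.L 1 v := by
  have h := LinearMap.congr_fun (𝕍.virasoro 0 1) v
  have h0 : mode 𝕍.Y 1 𝕍.conf v = (d : ℂ) • v := 𝕍.L_zero d v hv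
  simp only [VOA.L]
  norm_num [h0] at h ⊢
  rw [sub_eq_iff_eq_add] at h
  rw [h, sub_smul, one_smul]
  abel

theorem VOA.L_one_pow_mem (k : ℕ) {v : V} {d : ℕ} (hv : v ∈ 𝕍.gr (d + k)) :
    (𝕍.L 1 ^ k) v ∈ 𝕍.gr d := by
  induction k generalizing d with
  | zero => simpa using hv
  | succ k ih =>
    rw [pow_succ', Module.End.mul_apply]
    have h := ih (d := d + 1) (by rwa [show d + 1 + k = d + (k + 1) by ring])
    refine 𝕍.mem_gr_of_L_zero ?_
    rw [𝕍.L_zero_L_one h]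
    push_cast
    rw [add_sub_cancel_right]

/-- After `d` applications the weight is `0`; one more would produce an eigenvector of eigenvalue
`-1`. -/
theorem VOA.L_one_pow_eq_zero {v : V} {d k : ℕ} (hv : v ∈ 𝕍.gr d) (hk : d < k) :
    (𝕍.L 1 ^ k) v = 0 := by
  have h : 𝕍.L 1 ((𝕍.L 1 ^ d) v) = 0 := by
    have h0 := 𝕍.L_one_pow_mem d (d := 0) (by rwa [zero_add])
    refine 𝕍.eq_zero_of_L_zero ?_
    rw [𝕍.L_zero_L_one h0]
    simp
  obtain ⟨j, rfl⟩ : ∃ j, k = j + (1 + d) := ⟨k - (1 + d), by omega⟩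
  rw [pow_add, pow_add, pow_one, Module.End.mul_apply, Module.End.mul_apply, h, map_zero]

theorem VOA.exists_L_one_pow_eq_zero (v : V) : ∃ N : ℕ, ∀ k ≥ N, (𝕍.L 1 ^ k) v = 0 := by
  refine 𝕍.homogeneous_induction (p := fun v => ∃ N : ℕ, ∀ k ≥ N, (𝕍.L 1 ^ k) v = 0) v ?_ ?_ ?_
  · exact fun d v hv => ⟨d + 1, fun k hk => 𝕍.L_one_pow_eq_zero hv hk⟩
  · exact ⟨0, by simp⟩
  · rintro u v ⟨N, hN⟩ ⟨N', hN'⟩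
    exact ⟨max N N', fun k hk => by
      rw [map_add, hN k (le_trans (le_max_left _ _) hk), hN' k (le_trans (le_max_right _ _) hk),
        add_zero]⟩

/-! ### The series `γ_z` as the flow of a single vector field -/

open PowerSeries in
theorem flowStep_iterate_single (c : ℂ) (k : ℕ) :
    (flowStep fun i => if i = 0 then c else 0)^[k] X = C ((k.factorial : ℂ) * c ^ k) * X ^ (k + 1) := by
  have hc : PowerSeries.mk (fun i => if i = 0 then c else 0) = C c := by
    ext n; simp [coeff_C]
  induction k with
  | zero => simp
  | succ k ih =>
    rw [Function.iterate_succ_apply', ih, flowStep, hc, Derivation.leibniz, derivative_C,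
      Derivation.leibniz_pow, derivative_X]
    simp only [smul_eq_mul, nsmul_eq_mul, mul_one, Nat.add_sub_cancel,
      Nat.factorial_succ, map_mul, map_pow, Nat.cast_mul, map_natCast, pow_succ]
    ring

-- The flow of `c z² ∂_z` is the geometric series `z / (1 - cz)`: the factor `k!` of the `k`-th
-- iterate cancels the exponential denominator.
open PowerSeries in
theorem coeff_flow_single (c : ℂ) (m : ℕ) :
    coeff m (flow fun i => if i = 0 then c else 0) = if m = 0 then 0 else c ^ (m - 1) := by
  rw [flow, coeff_mk]
  have hterm : ∀ k, ((k.factorial : ℂ)⁻¹) *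
      coeff m ((flowStep fun i => if i = 0 then c else 0)^[k] X) = if m = k + 1 then c ^ k else 0 := by
    intro k
    rw [flowStep_iterate_single, coeff_C_mul, coeff_X_pow]
    have : (k.factorial : ℂ) ≠ 0 := Nat.cast_ne_zero.2 k.factorial_ne_zero
    split_ifs
    · field_simp
    · rw [mul_zero, mul_zero]
  simp only [hterm]
  cases m with
  | zero => simp
  | succ m => simp

open PowerSeries in
theorem coeff_gammaSeries {z : ℂ} (hz : z ≠ 0) (m : ℕ) :
    coeff m (gammaSeries z) = if m = 0 then 0 else (-1) ^ m * z⁻¹ ^ (m + 1) := by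
  have h : (C z + X : PowerSeries ℂ)⁻¹ = PowerSeries.mk fun n => (-1) ^ n * z⁻¹ ^ (n + 1) := by
    rw [PowerSeries.inv_eq_iff_mul_eq_one (by simpa using hz)]
    ext n
    rw [mul_add, map_add, coeff_mul_C]
    cases n with
    | zero => simp [hz]
    | succ n =>
      rw [coeff_succ_mul_X, coeff_mk, coeff_mk, coeff_one, if_neg n.succ_ne_zero, pow_succ,
        pow_succ z⁻¹ (n + 1)]
      field_simp
      ring
  rw [gammaSeries, h, map_sub, coeff_mk, coeff_C]
  split_ifs with hm <;> simp [hm]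

open PowerSeries in
theorem coeff_one_gammaSeries {z : ℂ} (hz : z ≠ 0) :
    coeff 1 (gammaSeries z) = -z ^ (-2 : ℤ) := by
  rw [coeff_gammaSeries hz, zpow_neg]
  norm_num

-- `γ_z(t) = -z^{-2} · t / (1 + t/z)` is a scaled geometric series, so by uniqueness of the
-- logarithm only `c_1 = -z⁻¹` survives and `𝒰(γ_z)` involves no `L(n)` with `n > 1`.
open PowerSeries in
theorem logCoeff_gammaSeries {z : ℂ} (hz : z ≠ 0) :
    logCoeff (gammaSeries z) = fun i => if i = 0 then -z⁻¹ else 0 := by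
  refine (logCoeff_unique _ ?_ _ ?_).symm
  · rw [coeff_one_gammaSeries hz]
    exact neg_ne_zero.2 (zpow_ne_zero _ hz)
  · ext m
    rw [coeff_smul, coeff_flow_single, coeff_gammaSeries hz, coeff_gammaSeries hz]
    cases m with
    | zero => simp
    | succ m =>
      simp only [Nat.succ_ne_zero, one_ne_zero, if_false, Nat.add_sub_cancel, smul_eq_mul]
      rw [neg_pow z⁻¹]
      ring

theorem VOA.positiveVirasoro_iterate (c : ℂ) (k : ℕ) (v : V) :
    (𝕍.positiveVirasoro fun i => if i = 0 then c else 0)^[k] v = c ^ k • (𝕍.L 1 ^ k) v := by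
  have h1 : ∀ v, 𝕍.positiveVirasoro (fun i => if i = 0 then c else 0) v = c • 𝕍.L 1 v := by
    intro v
    rw [VOA.positiveVirasoro, finsum_eq_single _ 0 (fun i hi => by simp [hi])]
    simp
  induction k with
  | zero => simp
  | succ k ih =>
    rw [Function.iterate_succ_apply', ih, h1, map_smul, smul_smul, pow_succ' (𝕍.L 1),
      Module.End.mul_apply, pow_succ']

theorem VOA.changeOfCoord_gammaSeries {z : ℂ} (hz : z ≠ 0) (v : V) :
    𝕍.changeOfCoord (gammaSeries z) v = ∑ᶠ d : ℕ, (-z ^ (-2 : ℤ)) ^ d •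
      (𝕍.decomp (∑ᶠ k : ℕ, ((k.factorial : ℂ)⁻¹ * (-z⁻¹) ^ k) • (𝕍.L 1 ^ k) v) d : V) := by
  simp only [VOA.changeOfCoord, coeff_one_gammaSeries hz, logCoeff_gammaSeries hz,
    𝕍.positiveVirasoro_iterate, smul_smul]

/-- `changeOfCoord` is built from `finsum`s, so additivity rests on finite supports: `L(1)` is
locally nilpotent, and a vector has finitely many homogeneous components. -/
theorem VOA.changeOfCoord_gammaSeries_add {z : ℂ} (hz : z ≠ 0) (u v : V) :
    𝕍.changeOfCoord (gammaSeries z) (u + v) =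
      𝕍.changeOfCoord (gammaSeries z) u + 𝕍.changeOfCoord (gammaSeries z) v := by
  have hfin : ∀ v, (Function.support fun k : ℕ =>
      ((k.factorial : ℂ)⁻¹ * (-z⁻¹) ^ k) • (𝕍.L 1 ^ k) v).Finite := by
    intro v
    obtain ⟨N, hN⟩ := 𝕍.exists_L_one_pow_eq_zero v
    refine (Set.finite_Iio N).subset fun k hk => ?_
    by_contra hlt
    exact hk (by simp only [hN k (not_lt.1 hlt), smul_zero])
  have hfin' : ∀ v, (Function.support fun d : ℕ =>
      (-z ^ (-2 : ℤ)) ^ d • (𝕍.decomp v d : V)).Finite := by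
    classical
    intro v
    refine (DFinsupp.support (𝕍.decomp v)).finite_toSet.subset fun d hd => ?_
    rw [Finset.mem_coe, DFinsupp.mem_support_toFun]
    intro h0
    refine hd ?_
    have h1 : 𝕍.decomp v d = 0 := h0
    simp only [h1, Submodule.coe_zero, smul_zero]
  simp only [𝕍.changeOfCoord_gammaSeries hz, map_add, smul_add]
  rw [finsum_add_distrib (hfin u) (hfin v), ← finsum_add_distrib (hfin' _) (hfin' _)]
  refine finsum_congr fun d => ?_
  rw [map_add, DirectSum.add_apply, Submodule.coe_add, smul_add]

/-- `𝒰(γ_z) = e^{zL(1)} (-z^{-2})^{L(0)}` on vectors of weight `d`. -/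
theorem VOA.changeOfCoord_gammaSeries_of_mem {z : ℂ} (hz : z ≠ 0) {v : V} {d : ℕ}
    (hv : v ∈ 𝕍.gr d) :
    𝕍.changeOfCoord (gammaSeries z) v = ∑ k ∈ Finset.range (d + 1),
      ((-1 : ℂ) ^ d * (k.factorial : ℂ)⁻¹ * z ^ ((k : ℤ) - 2 * d)) • (𝕍.L 1 ^ k) v := by
  have h1 : ∑ᶠ k : ℕ, ((k.factorial : ℂ)⁻¹ * (-z⁻¹) ^ k) • (𝕍.L 1 ^ k) v =
      ∑ k ∈ Finset.range (d + 1), ((k.factorial : ℂ)⁻¹ * (-z⁻¹) ^ k) • (𝕍.L 1 ^ k) v := by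
    refine finsum_eq_sum_of_support_subset _ fun k hk => ?_
    by_contra hk'
    refine hk ?_
    simp only [Finset.coe_range, Set.mem_Iio, not_lt] at hk'
    simp only [𝕍.L_one_pow_eq_zero hv hk', smul_zero]
  have hmem : ∀ k ∈ Finset.range (d + 1), (𝕍.L 1 ^ k) v ∈ 𝕍.gr (d - k) := fun k hk =>
    𝕍.L_one_pow_mem k (by rwa [Nat.sub_add_cancel (by simpa [Nat.lt_succ_iff] using hk)])
  rw [𝕍.changeOfCoord_gammaSeries hz, h1,
    finsum_eq_sum_of_support_subset (s := Finset.range (d + 1))]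
  · have h2 : ∀ e, (𝕍.decomp (∑ k ∈ Finset.range (d + 1),
        ((k.factorial : ℂ)⁻¹ * (-z⁻¹) ^ k) • (𝕍.L 1 ^ k) v) e : V) =
        ∑ k ∈ Finset.range (d + 1), if d - k = e then
          ((k.factorial : ℂ)⁻¹ * (-z⁻¹) ^ k) • (𝕍.L 1 ^ k) v else 0 := by
      intro e
      rw [map_sum, DFinsupp.finsetSum_apply, Submodule.coe_sum]
      refine Finset.sum_congr rfl fun k hk => ?_
      rw [map_smul, DirectSum.smul_apply, 𝕍.decomp_of_mem (hmem k hk), DirectSum.lof_eq_of,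
        Submodule.coe_smul]
      split_ifs with h
      · subst h
        rw [DirectSum.of_eq_same]
      · rw [DirectSum.of_eq_of_ne _ _ _ (Ne.symm h), Submodule.coe_zero, smul_zero]
    simp only [h2, Finset.smul_sum]
    rw [Finset.sum_comm]
    refine Finset.sum_congr rfl fun k hk => ?_
    have hkd : k ≤ d := by simpa [Nat.lt_succ_iff] using hk
    rw [Finset.sum_eq_single (d - k) (fun e _ he => by rw [if_neg (Ne.symm he), smul_zero])
      (fun h => absurd (Finset.mem_range.2 (by omega)) h), if_pos rfl, smul_smul]
    -- `L(1)^k v` has weight `d - k`, and `(-z^{-2})^{d-k} (-z⁻¹)^k = (-1)^d z^{k-2d}`.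
    congr 1
    obtain ⟨j, rfl⟩ := Nat.exists_eq_add_of_le hkd
    rw [Nat.add_sub_cancel_left, neg_pow, neg_pow z⁻¹, pow_add, ← zpow_natCast (z ^ (-2 : ℤ)) j,
      ← zpow_mul, inv_pow, ← zpow_natCast z k, ← zpow_neg,
      show (k : ℤ) - 2 * ((k + j : ℕ) : ℤ) = (-2) * (j : ℤ) + -(k : ℤ) by push_cast; ring,
      zpow_add₀ hz]
    ring
  · intro e he
    by_contra he'
    refine he ?_
    have h0 : 𝕍.decomp (∑ k ∈ Finset.range (d + 1),
        ((k.factorial : ℂ)⁻¹ * (-z⁻¹) ^ k) • (𝕍.L 1 ^ k) v) e = 0 := by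
      rw [map_sum, DFinsupp.finsetSum_apply]
      refine Finset.sum_eq_zero fun k hk => ?_
      have : e ≠ d - k := by
        simp only [Finset.coe_range, Set.mem_Iio, not_lt] at he'
        omega
      rw [map_smul, DirectSum.smul_apply, 𝕍.decomp_of_mem (hmem k hk), DirectSum.lof_eq_of,
        DirectSum.of_eq_of_ne _ _ _ this, smul_zero]
    simp only [h0, Submodule.coe_zero, smul_zero]

/-! ### The correlation function in the coordinates `z` and `1/z` -/

variable {𝕍}

/-- Functionals `ψ'` are dual to `ψ` if they are the modes of `∑ n, ψ_n(𝒰(γ_z) v) z^{n+1}`. -/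
def IsDualFamily (𝕍 : VOA V) (ψ ψ' : ℤ → V →ₗ[ℂ] ℂ) : Prop :=
  ∀ (d : ℕ), ∀ v ∈ 𝕍.gr d, ∀ n : ℤ, ψ' n v = ∑ k ∈ Finset.range (d + 1),
    ((-1 : ℂ) ^ d * (k.factorial : ℂ)⁻¹) * ψ (2 * d - k - n - 2) ((𝕍.L 1 ^ k) v)

theorem IsDualFamily.finite_support {ψ ψ' : ℤ → V →ₗ[ℂ] ℂ} (h : IsDualFamily 𝕍 ψ ψ')
    (hψ : ∀ v, (Function.support fun n => ψ n v).Finite) (v : V) :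
    (Function.support fun n => ψ' n v).Finite := by
  refine 𝕍.homogeneous_induction (p := fun v => (Function.support fun n => ψ' n v).Finite) v ?_ ?_ ?_
  · intro d v hv
    simp only [h d v hv]
    refine Set.Finite.subset (Set.Finite.biUnion (Finset.range (d + 1)).finite_toSet fun k _ =>
      (hψ ((𝕍.L 1 ^ k) v)).preimage (f := fun n : ℤ => 2 * d - k - n - 2) ?_) ?_
    · intro a _ b _ hab
      simp only at hab
      omega
    · intro n hn
      obtain ⟨k, hk, hk'⟩ := Finset.exists_ne_zero_of_sum_ne_zero hn
      exact Set.mem_biUnion hk (right_ne_zero_of_mul hk')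
  · simp
  · intro u v hu hv
    refine (hu.union hv).subset fun n hn => ?_
    by_contra hn'
    simp only [Set.mem_union, Function.mem_support, not_or, not_not] at hn'
    exact hn (by simp only [map_add, hn'.1, hn'.2, add_zero])

/-- Both sides are additive in `v`, so homogeneous vectors suffice; there the expansion of `𝒰(γ_z)
v` matches the definition of the dual family term by term. -/
theorem IsDualFamily.modeSum_eq {ψ ψ' : ℤ → V →ₗ[ℂ] ℂ} (h : IsDualFamily 𝕍 ψ ψ')
    (hψ : ∀ v, (Function.support fun n => ψ n v).Finite)
    (hψ' : ∀ v, (Function.support fun n => ψ' n v).Finite) {z : ℂ} (hz : z ≠ 0) (v : V) :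
    modeSum ψ' hψ' z v = modeSum ψ hψ z⁻¹ (𝕍.changeOfCoord (gammaSeries z) v) := by
  have hadd := 𝕍.changeOfCoord_gammaSeries_add hz
  refine 𝕍.homogeneous_induction (p := fun v =>
    modeSum ψ' hψ' z v = modeSum ψ hψ z⁻¹ (𝕍.changeOfCoord (gammaSeries z) v)) v ?_ ?_ ?_
  · intro d v hv
    rw [𝕍.changeOfCoord_gammaSeries_of_mem hz hv, modeSum_eq_finsum, map_sum]
    simp only [h d v hv, Finset.sum_mul, map_smul]
    rw [finsum_sum_comm]
    · refine Finset.sum_congr rfl fun k _ => ?_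
      -- For fixed `k`, the substitution `n ↦ 2d - k - 2 - n` aligns the modes of `ψ'` and `ψ`; the
      -- powers of `z` then agree.
      rw [modeSum_eq_finsum, smul_finsum,
        ← finsum_comp_equiv (Equiv.subLeft (2 * d - k - 2 : ℤ))]
      refine finsum_congr fun n => ?_
      rw [Equiv.subLeft_apply, smul_eq_mul, inv_zpow, ← zpow_neg,
        show (2 * d - k - (2 * d - k - 2 - n) - 2 : ℤ) = n by ring,
        show (-(2 * d - k - 2 - n) - 1 : ℤ) = (k - 2 * d) + -(-n - 1) by ring, zpow_add₀ hz]
      ring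
    · intro k _
      refine ((hψ ((𝕍.L 1 ^ k) v)).preimage (f := fun n : ℤ => 2 * d - k - n - 2) ?_).subset
        fun n hn => right_ne_zero_of_mul (left_ne_zero_of_mul hn)
      intro a _ b _ hab
      simp only at hab
      omega
  · have h0 : 𝕍.changeOfCoord (gammaSeries z) 0 = 0 := by simpa using hadd 0 0
    rw [h0, map_zero, map_zero]
  · intro u v hu hv
    rw [hadd, map_add, map_add, hu, hv]

end Gamma

end PseudoTraceBlock

end

noncomputable section

namespace PseudoTraceBlock

/-! ### Cyclicity of the pseudo-trace -/

section Cyclic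

variable {V : Type*} [AddCommGroup V] [Module ℂ V] {𝕍 : VOA V}
  {M : Type*} [AddCommGroup M] [Module ℂ M] {𝕄 : 𝕍.WeakModule M}
  {A : Subalgebra ℂ (Module.End ℂ M)}

/-- `Tr^ω(Y_M(v)_n ∘ T) = Tr^ω(T ∘ Y_M(v)_n)`. -/
theorem VOA.WeakModule.pseudoTrace_leftMode (hM : 𝕄.GradingRestricted) (hA : A ≤ 𝕄.endAlg)
    [Module.Projective A M] (ω : A →ₗ[ℂ] ℂ) (hω : ∀ a b, ω (a * b) = ω (b * a))
    (v : V) (n : ℤ) (T : 𝕄.endZero A) :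
    pseudoTrace hM ω hω (leftMode hA n v T) = pseudoTrace hM ω hω (rightMode hA n v T) := by
  obtain ⟨p⟩ := nonempty_factorization hM T.2
  let y : M →ₗ[A] M :=
    { toFun := mode 𝕄.Y n v
      map_add' := map_add _
      map_smul' := fun a x => LinearMap.congr_fun (mode_commute hA a.2 n v) x }
  let q : FiniteFactorization A (mode 𝕄.Y n v * T.1 : Module.End ℂ M) :=
    ⟨p.n, fun i => y (p.u i), p.form, fun x => by
      have h : (mode 𝕄.Y n v * T.1) x = y (T.1 x) := rfl
      rw [h, p.eq, map_sum]
      exact Finset.sum_congr rfl fun i _ => map_smul y _ _⟩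
  let r : FiniteFactorization A (T.1 * mode 𝕄.Y n v : Module.End ℂ M) :=
    ⟨p.n, p.u, fun i => p.form i ∘ₗ y, fun x => p.eq _⟩
  -- Both factorizations have the same trace `∑ ω(α_i(y u_i))`, definitionally.
  exact (pseudoTraceFun_eq q ω hω).trans (pseudoTraceFun_eq r ω hω).symm

theorem mode_leftY (hM : 𝕄.GradingRestricted) (hA : A ≤ 𝕄.endAlg) (n : ℤ) :
    mode (VOA.WeakModule.leftY hM hA) n = VOA.WeakModule.leftMode hA n :=
  mode_ofModes _ _ n

theorem mode_rightY (hM : 𝕄.GradingRestricted) (hA : A ≤ 𝕄.endAlg) (n : ℤ) :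
    mode (VOA.WeakModule.rightY hM hA) n = VOA.WeakModule.rightDualMode hA n :=
  mode_ofModes _ _ n

theorem VOA.WeakModule.rightDualMode_of_mem (hA : A ≤ 𝕄.endAlg) {d : ℕ} {v : V}
    (hv : v ∈ 𝕍.gr d) (n : ℤ) (T : 𝕄.endZero A) :
    rightDualMode hA n v T = ∑ k ∈ Finset.range (d + 1),
      ((-1 : ℂ) ^ d * (k.factorial : ℂ)⁻¹) •
        rightMode hA (2 * d - k - n - 2) ((𝕍.L 1 ^ k) v) T := by
  simp only [rightDualMode, LinearMap.comp_apply, LinearEquiv.coe_coe, 𝕍.decomp_of_mem hv,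
    DirectSum.toModule_lof, Submodule.subtype_apply, LinearMap.sum_apply, LinearMap.smul_apply]

/-- The trace functions `v ↦ Tr^ω(Y_M(v)_n ∘ T)`. -/
def VOA.WeakModule.traceFunctional (hM : 𝕄.GradingRestricted) (hA : A ≤ 𝕄.endAlg)
    [Module.Projective A M] (ω : A →ₗ[ℂ] ℂ) (hω : ∀ a b, ω (a * b) = ω (b * a))
    (T : 𝕄.endZero A) (n : ℤ) : V →ₗ[ℂ] ℂ :=
  pseudoTrace hM ω hω ∘ₗ (leftMode hA n).flip T

/-- Large modes kill `T` from the left; very negative ones, moved to the right of `T` by cyclicity,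
also give zero. -/
theorem VOA.WeakModule.finite_support_traceFunctional (hM : 𝕄.GradingRestricted)
    (hA : A ≤ 𝕄.endAlg) [Module.Projective A M] (ω : A →ₗ[ℂ] ℂ)
    (hω : ∀ a b, ω (a * b) = ω (b * a)) (T : 𝕄.endZero A) (v : V) :
    (Function.support fun n => traceFunctional hM hA ω hω T n v).Finite := by
  obtain ⟨N, hN⟩ := mode_mul_eventually_zero hM v T.2
  obtain ⟨N', hN'⟩ := mul_mode_eventually_zero hM v T.2
  refine (Set.finite_Ioo N' N).subset fun n hn => ⟨?_, ?_⟩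
  · by_contra hlt
    have h0 : rightMode hA n v T = 0 := Subtype.ext (hN' n (not_lt.1 hlt))
    refine hn (Eq.trans (pseudoTrace_leftMode hM hA ω hω v n T) ?_)
    rw [h0, map_zero]
  · by_contra hlt
    have h0 : leftMode hA n v T = 0 := Subtype.ext (hN n (not_lt.1 hlt))
    refine hn (Eq.trans (congrArg (pseudoTrace hM ω hω) h0) (map_zero _))

end Cyclic

/-! ### Sections over the sphere -/

section Sections

variable {V : Type*} [AddCommGroup V] [Module ℂ V]
  {E : Type*} [NormedAddCommGroup E] [NormedSpace ℂ E]
  {B : Type*} [TopologicalSpace B] [ChartedSpace E B]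

/-- Restriction of a section to a fibre of `ℂ × B → B`. -/
theorem IsSectionOn.exists_fiber {σ : ℂ × B → V} {U : Set (ℂ × B)}
    (h : IsSectionOn (𝓘(ℂ, ℂ).prod 𝓘(ℂ, E)) σ U) {z : ℂ} {b : B} (hU : ∀ᶠ ζ in 𝓝 z, (ζ, b) ∈ U) :
    ∃ (n : ℕ) (g : Fin n → ℂ → ℂ) (w : Fin n → V), (∀ i, AnalyticAt ℂ (g i) z) ∧
      ∀ᶠ ζ in 𝓝 z, σ (ζ, b) = ∑ i, g i ζ • w i := by
  obtain ⟨O, hO, hmem, n, g, w, hg, heq⟩ := h (z, b) hU.self_of_nhds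
  have hcont : Continuous fun ζ : ℂ => (ζ, b) := by fun_prop
  have hO' : IsOpen ((fun ζ : ℂ => (ζ, b)) ⁻¹' O) := hO.preimage hcont
  refine ⟨n, fun i ζ => g i (ζ, b), w, fun i => ?_, ?_⟩
  · have hmd : MDifferentiable 𝓘(ℂ, ℂ) (𝓘(ℂ, ℂ).prod 𝓘(ℂ, E)) fun ζ : ℂ => (ζ, b) :=
      mdifferentiable_id.prodMk mdifferentiable_const
    have := (hg i).comp hmd.mdifferentiableOn (s := (fun ζ : ℂ => (ζ, b)) ⁻¹' O) fun ζ hζ => hζ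
    exact (mdifferentiableOn_iff_differentiableOn.1 this).analyticAt (hO'.mem_nhds hmem)
  · filter_upwards [hU, hO'.mem_nhds hmem] with ζ h1 h2
    exact heq _ ⟨h2, h1⟩

/-- The finite pole condition supplies an expansion, so the default value `0` of `residue` is never
used. Which expansion is chosen is immaterial: every admissible value is evaluated by the same
contour integral. -/
theorem IsMeromorphicSection.isResidue_residue {D : Set B} {σ : ℂ × B → V}
    (h : IsMeromorphicSection (E := E) D σ) {b : B} (hb : b ∈ D) {W : Type*} [AddCommGroup W]
    [Module ℂ W] (Y : V →ₗ[ℂ] VertexOperator ℂ W) (w : W) :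
    IsResidue Y (fun ζ => σ (ζ, b)) w (residue Y (fun ζ => σ (ζ, b)) w) := by
  have hex : ∃ r, IsResidue Y (fun ζ => σ (ζ, b)) w r := by
    obtain ⟨O, hO, hmem, k, τ, hτ, heq⟩ := h.finite_poles b hb
    have hU : ∀ᶠ ζ in 𝓝 (0 : ℂ), (ζ, b) ∈ O :=
      (hO.preimage (show Continuous fun ζ : ℂ => (ζ, b) by fun_prop)).mem_nhds hmem
    obtain ⟨n, g, v, hg, hgv⟩ := hτ.exists_fiber hU
    refine ⟨_, k, n, g, v, hg, ?_, rfl⟩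
    rw [eventually_nhdsWithin_iff]
    filter_upwards [hU, hgv] with ζ h1 h2 h3
    rw [heq _ h1 h3 hb, h2]
  rw [residue, dif_pos hex]
  exact hex.choose_spec

/-- Locally `σ = ∑ g_i w_i`, so linearity of `modeSum` gives a finite sum of holomorphic functions
times Laurent polynomials. -/
theorem IsMeromorphicSection.differentiableAt_modeSum {D : Set B} {σ : ℂ × B → V}
    (h : IsMeromorphicSection (E := E) D σ) {b : B} (hb : b ∈ D) {ψ : ℤ → V →ₗ[ℂ] ℂ}
    (hψ : ∀ v, (Function.support fun n => ψ n v).Finite) {z : ℂ} (hz : z ≠ 0) :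
    DifferentiableAt ℂ (fun z => modeSum ψ hψ z (σ (z, b))) z := by
  obtain ⟨n, g, w, hg, hgw⟩ := h.holomorphic.exists_fiber (z := z) (b := b)
    ((eventually_ne_nhds hz).mono fun ζ hζ => ⟨hζ, hb⟩)
  have hd : DifferentiableAt ℂ (fun z => ∑ i, g i z * modeSum ψ hψ z (w i)) z :=
    DifferentiableAt.fun_sum fun i _ =>
      (hg i).differentiableAt.mul (PseudoTraceBlock.differentiableAt_modeSum _ hz)
  refine hd.congr_of_eventuallyEq ?_
  filter_upwards [hgw] with ζ hζ
  simp [hζ]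

end Sections

end PseudoTraceBlock

end

/-! ### The pseudo-trace as a conformal block -/

theorem mainTheorem12
    {V : Type*} [AddCommGroup V] [Module ℂ V] (𝕍 : PseudoTraceBlock.VOA V)
    {M : Type*} [AddCommGroup M] [Module ℂ M] (𝕄 : 𝕍.WeakModule M) (hM : 𝕄.GradingRestricted)
    (A : Subalgebra ℂ (Module.End ℂ M)) (hA : A ≤ 𝕄.endAlg) [Module.Projective A M]
    (ω : A →ₗ[ℂ] ℂ) (hω : ∀ a b : A, ω (a * b) = ω (b * a))
    {E : Type*} [NormedAddCommGroup E] [NormedSpace ℂ E] [FiniteDimensional ℂ E]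
    (B : Type*) [TopologicalSpace B] [ChartedSpace E B] [IsManifold 𝓘(ℂ, E) ⊤ B] :
    PseudoTraceBlock.IsConformalBlock (E := E) (B := B) 𝕍
        (PseudoTraceBlock.VOA.WeakModule.leftY hM hA)
        (PseudoTraceBlock.VOA.WeakModule.rightY hM hA)
        ((Algebra.linearMap ℂ (PseudoTraceBlock.holomorphicFunctions (E := E) B)) ∘ₗ
          PseudoTraceBlock.VOA.WeakModule.pseudoTrace hM ω hω) ∧
      ∀ (v : V) (n : ℤ) (T : 𝕄.endZero A),
        PseudoTraceBlock.VOA.WeakModule.pseudoTrace hM ω hω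
            (PseudoTraceBlock.VOA.WeakModule.leftMode hA n v T) =
          PseudoTraceBlock.VOA.WeakModule.pseudoTrace hM ω hω
            (PseudoTraceBlock.VOA.WeakModule.rightMode hA n v T) := by
  refine ⟨?_, fun v n T => PseudoTraceBlock.VOA.WeakModule.pseudoTrace_leftMode hM hA ω hω v n T⟩
  intro D _ σinf σzero hσ w _ b hb
  let T := w b
  let ψ := PseudoTraceBlock.VOA.WeakModule.traceFunctional hM hA ω hω T
  let ψ' : ℤ → V →ₗ[ℂ] ℂ := fun n => PseudoTraceBlock.VOA.WeakModule.pseudoTrace hM ω hω ∘ₗ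
    (PseudoTraceBlock.VOA.WeakModule.rightDualMode hA n).flip T
  have hψ : ∀ v, (Function.support fun n => ψ n v).Finite :=
    PseudoTraceBlock.VOA.WeakModule.finite_support_traceFunctional hM hA ω hω T
  have hdual : PseudoTraceBlock.IsDualFamily 𝕍 ψ ψ' := by
    intro d v hv n
    have h := PseudoTraceBlock.VOA.WeakModule.rightDualMode_of_mem hA hv n T
    refine (congrArg (PseudoTraceBlock.VOA.WeakModule.pseudoTrace hM ω hω) h).trans ?_
    rw [map_sum]
    refine Finset.sum_congr rfl fun k _ => ?_
    -- Cyclicity turns the right modes into left modes, so that a single family `ψ` describes both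
    -- marked points.
    rw [map_smul, ← PseudoTraceBlock.VOA.WeakModule.pseudoTrace_leftMode]
    rfl
  have hψ' := hdual.finite_support hψ
  have hinf := hσ.inf.isResidue_residue hb (PseudoTraceBlock.VOA.WeakModule.leftY hM hA) T
  have hzero := hσ.zero.isResidue_residue hb (PseudoTraceBlock.VOA.WeakModule.rightY hM hA) T
  -- The conformal block takes constant functions as values, so evaluation at `b` is the
  -- pseudo-trace itself, definitionally.
  refine Eq.trans (map_add (PseudoTraceBlock.VOA.WeakModule.pseudoTrace hM ω hω) _ _)
    (PseudoTraceBlock.residue_sphere (fun z hz => hσ.zero.differentiableAt_modeSum hb hψ' hz) ?_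
      (hzero.eventually_circleIntegral _ fun n v => by
        rw [PseudoTraceBlock.mode_rightY]; rfl)
      (hinf.eventually_circleIntegral (ψ := ψ) (hψ := hψ) _ fun n v => by
        rw [PseudoTraceBlock.mode_leftY]; rfl))
  -- It remains to see that the two integrands are the same 1-form: `𝒰(γ_z) σzero = γ_z'(0) σinf`,
  -- and `γ_z'(0) = -z^{-2}` is exactly the factor in `dt = -z^{-2} dz`.
  intro z hz
  rw [hdual.modeSum_eq hψ hψ' hz, ← hσ.transition b hb z hz,
    PseudoTraceBlock.coeff_one_gammaSeries hz, map_smul, smul_eq_mul, neg_mul]
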